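/- All graphs are finite and simple and $\log$ is the natural logarithm. For a graph $G$ let $d(G)$ be its average degree, $\delta(G)$ its minimum degree, and for $X\subseteq V(G)$ let $N_G(X)$ be the set of vertices outside $X$ that have a neighbour in $X$. For $\varepsilon_1>0$ and real $k>0$ put $\varepsilon(x)=0$ if $x<k/5$ and $\varepsilon(x)=\varepsilon_1/\log^2(15x/k)$ if $x\ge k/5$. A graph $G$ is an $(\varepsilon_1,k)$-robust-expander if for every $X\subseteq V(G)$ with $k/2\le |X|\le |V(G)|/2$ and every subgraph $F\subseteq G$ with $e(F)\le d(G)\,\varepsilon(|X|)\,|X|$ we have $|N_{G\setminus F}(X)|\ge \varepsilon(|X|)\,|X|$, where $G\setminus F$ is $G$ with the edges of $F$ removed. For integers $t,\ell\ge 0$ let $\mathsf{TK}_t^{(\ell)}$ denote the subdivision of the complete graph $K_t$ in which each edge is replaced by a path with exactly $\ell$ internal vertices (i.e. of length $\ell+1$), these paths being internally vertex-disjoint. **Theorem.** For all $0<\varepsilon_1,\varepsilon_2<1$ there is $K_0=K_0(\varepsilon_1,\varepsilon_2)$ such that the following holds for every $K\ge K_0$. Let $d>0$ be real and let $G$ be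 an $n$-vertex bipartite $(\varepsilon_1,\varepsilon_2 d)$-robust-expander with $\delta(G)\ge d$, $n\ge Kd$ and $d\ge (\log n)^{800}$, and set $m=\lfloor \log^4(n/d)\rfloor$. Then $G$ contains a copy of $\mathsf{TK}_{\lceil \sqrt d\, m\rceil}^{(\ell)}$ with $\ell=1$ or $\ell=80m^3-1$; that is, a balanced subdivision of the complete graph on $\lceil \sqrt d\, m\rceil$ vertices in which either all subdivided edges are paths of length $2$ or all are paths of length $80m^3$. -/

import Mathlib

namespace BalancedSubdivision

/-- The average degree `d(G)` of a finite graph. -/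
noncomputable def avgDegree {V : Type*} [Fintype V] (G : SimpleGraph V) [DecidableRel G.Adj] : ℝ :=
  (∑ v : V, (G.degree v : ℝ)) / (Fintype.card V : ℝ)

/-- The external neighbourhood `N_G(X)`: vertices outside `X` with a neighbour in `X`. -/
def extNbhd {V : Type*} (G : SimpleGraph V) (X : Set V) : Set V :=
  {w | w ∉ X ∧ ∃ v ∈ X, G.Adj v w}

/-- The expansion function `ε(x, ε₁, k)` (natural logarithm). -/
noncomputable def expansion (ε₁ k x : ℝ) : ℝ :=
  if x < k / 5 then 0 else ε₁ / Real.log (15 * x / k) ^ 2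

/-- `G` is an `(ε₁, k)`-robust-expander. The graph `G \ F` has the vertex set of `G` and the edge
set `E(G) \ E(F)`. -/
def IsRobustExpander {V : Type*} [Fintype V] (G : SimpleGraph V) [DecidableRel G.Adj]
    (ε₁ k : ℝ) : Prop :=
  ∀ X : Finset V, k / 2 ≤ (X.card : ℝ) → (X.card : ℝ) ≤ (Fintype.card V : ℝ) / 2 →
    ∀ F : SimpleGraph V, F ≤ G →
      (F.edgeSet.ncard : ℝ) ≤ avgDegree G * expansion ε₁ k X.card * X.card →
      expansion ε₁ k X.card * X.card ≤ ((extNbhd (G \ F) (X : Set V)).ncard : ℝ)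

/-- `G` contains a copy of `TK_t^(ℓ)`, a balanced subdivision of `K_t` in which every edge is
replaced by a path with exactly `ℓ` internal vertices (a path of length `ℓ + 1`): there are `t`
distinct branch vertices `c i` and, for every pair `i < j`, a path `P i j` in `G` from `c i` to
`c j` of length `ℓ + 1`, which meets no other branch vertex, and such that an internal vertex of
one path lies on no other path. -/
def ContainsTK {V : Type*} (G : SimpleGraph V) (t ℓ : ℕ) : Prop :=
  ∃ (c : Fin t ↪ V) (P : ∀ i j : Fin t, i < j → G.Walk (c i) (c j)),
    (∀ i j (h : i < j), (P i j h).IsPath ∧ (P i j h).length = ℓ + 1) ∧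
    (∀ i j (h : i < j) (k : Fin t), c k ∈ (P i j h).support → k = i ∨ k = j) ∧
    (∀ i j (h : i < j) i' j' (h' : i' < j'), (i, j) ≠ (i', j') →
      ∀ v ∈ (P i j h).support, v ≠ c i → v ≠ c j → v ∉ (P i' j' h').support)

/-- The parameter `m = ⌊log⁴ (n / d)⌋`. -/
noncomputable def mParam (n : ℕ) (d : ℝ) : ℕ := ⌊Real.log ((n : ℝ) / d) ^ 4⌋₊

end BalancedSubdivision

set_option linter.unusedSectionVars false

namespace BalancedSubdivision

open Finset

/-! Let t be the number of branch vertices; all that matters about it is d ≤ t² ≤ 4dm². The proof is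
a dichotomy. Suppose some U with |U| ≤ dm²² contains at least d/2 neighbours of every vertex of the
larger colour class outside U. Then dependent random choice (`exists_subset_large_codegree`) finds t
vertices of U with at least t² common neighbours for each pair, and Hall's theorem picks distinct
midpoints (`containsTK_one_of_codegree`): this is ℓ = 1. Otherwise stars with about d/2 leaves exist
off every such U (`exists_star_avoiding`), and the long subdivision is built greedily.

The engine is `EdgeExpanding.exists_path_of_length`: two large sets A, B in one colour class are
joined, off a much smaller set W, by a path of any prescribed even length T with m ≤ T < m⁴. Robust
expansion is turned into the edge count `EdgeExpanding` with rate 1/e, where e is of order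
log²(n/d). A set then grows through a very small part of itself, so A and B both reach almost every
vertex within 2r ≤ m/2 steps, using few inner vertices, disjoint for the two sides. The set Z
reached from both sides spans many edges. Label its vertices by the length of a chosen path to A; a
popular pair of labels carries a subgraph of large minimum degree, in which a path of any desired
length can be grown. Bipartiteness determines the label at its end, so the total length is exactly
T.

The t²/2 or so paths needed, each of length about m³, have far more than d vertices in total and
could swallow the neighbourhood of any single vertex. Each branch vertex is therefore the root of a
hub: 2t paths to tips, every tip carrying 2tm¹⁰ leaves (`EdgeExpanding.exists_hub`). Even after t
tips are spent, a hub keeps at least 2dm¹⁰ leaves, against at most dm⁶ vertices ever in use, so the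
joining never gets stuck (`EdgeExpanding.containsTK`). -/

/-- Sequential choice: a sequence of objects subject to a unary condition at each index and a
binary condition between any two of them can be built greedily. -/
theorem exists_greedy_sequence {α : Type*} [Nonempty α] (Q : ℕ) (U : ℕ → α → Prop)
    (r : α → α → Prop)
    (h : ∀ q < Q, ∀ f : ℕ → α, (∀ i < q, U i (f i)) → (∀ j < q, ∀ i < j, r (f i) (f j)) →
      ∃ x, U q x ∧ ∀ i < q, r (f i) x) :
    ∃ f : ℕ → α, (∀ i < Q, U i (f i)) ∧ ∀ j < Q, ∀ i < j, r (f i) (f j) := by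
  have key : ∀ q ≤ Q, ∃ f : ℕ → α, (∀ i < q, U i (f i)) ∧ ∀ j < q, ∀ i < j, r (f i) (f j) := by
    intro q
    induction q with
    | zero => intro _; exact ⟨fun _ => Classical.arbitrary α, by simp, by simp⟩
    | succ q ih =>
      intro hq
      obtain ⟨f, hf1, hf2⟩ := ih (by omega)
      obtain ⟨x, hx1, hx2⟩ := h q (by omega) f hf1 hf2
      refine ⟨Function.update f q x, ?_, ?_⟩
      · intro i hi
        rcases Nat.lt_succ_iff_lt_or_eq.1 hi with hi | rfl
        · rw [Function.update_of_ne hi.ne]; exact hf1 i hi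
        · simpa using hx1
      · intro j hj i hij
        rcases Nat.lt_succ_iff_lt_or_eq.1 hj with hj | rfl
        · rw [Function.update_of_ne hj.ne, Function.update_of_ne (hij.trans hj).ne]
          exact hf2 j hj i hij
        · rw [Function.update_of_ne hij.ne]; simpa using hx2 i hij
  exact key Q le_rfl

/-! ### Edge expansion and growth through sparse sources -/

section Expansion

variable {V : Type*} [Fintype V] [DecidableEq V] (G : SimpleGraph V) [DecidableRel G.Adj]

/-- All vertices with a neighbour in `S`. -/
def nbrs (S : Finset V) : Finset V := univ.filter fun v => ∃ s ∈ S, G.Adj s v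

theorem mem_nbrs {S : Finset V} {v : V} : v ∈ nbrs G S ↔ ∃ s ∈ S, G.Adj s v := by
  simp [nbrs]

/-- If `X` and `Z` are disjoint and cover nearly everything in proportion to `X`, then there are
many edges between them. -/
def EdgeExpanding (d e : ℕ) : Prop :=
  ∀ X Z : Finset V, Disjoint X Z → d ≤ X.card → 2 * X.card ≤ Fintype.card V →
    e * (X ∪ Z)ᶜ.card < X.card → d * X.card < e * ∑ x ∈ X, (Z.filter (G.Adj x)).card

variable {G}

/-- A largest S that gains `M` vertices of `Y` per element works: if it is below the cap `c`, an `x`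
with `M` neighbours in `Y` not yet seen could be added. The second alternative bounds the edges from
`X` to the unseen part of `Y`, which is what edge expansion contradicts. -/
theorem exists_maximal_sparse_source (X Y : Finset V) (M c : ℕ) (hM : 0 < M) :
    ∃ S ⊆ X, S.card ≤ c ∧ M * S.card ≤ (Y ∩ nbrs G S).card ∧
      (S.card = c ∨ ∀ x ∈ X, ((Y \ nbrs G S).filter (G.Adj x)).card < M) := by
  obtain ⟨S, hS, hmax⟩ := Finset.exists_max_image
    (X.powerset.filter fun S => S.card ≤ c ∧ M * S.card ≤ (Y ∩ nbrs G S).card) Finset.card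
    ⟨∅, by simp⟩
  simp only [mem_filter, mem_powerset] at hS hmax
  refine ⟨S, hS.1, hS.2.1, hS.2.2, ?_⟩
  by_contra! hcon
  obtain ⟨hc, x, hx, hxM⟩ := hcon
  have hxS : x ∉ S := by
    intro hxS
    have : (Y \ nbrs G S).filter (G.Adj x) = ∅ := by
      ext v
      simp only [mem_filter, mem_sdiff, mem_nbrs, notMem_empty, iff_false]
      rintro ⟨⟨_, h⟩, h'⟩
      exact h ⟨x, hxS, h'⟩
    rw [this] at hxM
    simp at hxM
    omega
  have hcard := card_insert_of_notMem hxS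
  have h := hmax (insert x S) ⟨insert_subset hx hS.1, by have := hS.2.1; omega, ?_⟩
  · omega
  · rw [hcard]
    have hsub : (Y ∩ nbrs G S) ∪ ((Y \ nbrs G S).filter (G.Adj x)) ⊆ Y ∩ nbrs G (insert x S) := by
      intro v
      simp only [mem_union, mem_inter, mem_filter, mem_sdiff, mem_nbrs]
      rintro (⟨h1, s, hs, h2⟩ | ⟨⟨h1, _⟩, h2⟩)
      · exact ⟨h1, s, mem_insert_of_mem hs, h2⟩
      · exact ⟨h1, x, mem_insert_self _ _, h2⟩
    have hdisj : Disjoint (Y ∩ nbrs G S) ((Y \ nbrs G S).filter (G.Adj x)) := by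
      rw [Finset.disjoint_left]
      intro v hv hv'
      simp only [mem_filter, mem_sdiff, mem_inter] at hv hv'
      exact hv'.1.2 hv.2
    have := card_le_card hsub
    rw [card_union_of_disjoint hdisj] at this
    have := hS.2.2
    rw [Nat.mul_add]
    omega

/-- A set of moderate size grows through the neighbourhood of a very small part of it. -/
theorem EdgeExpanding.exists_sparse_source {d e : ℕ} (hG : EdgeExpanding G d e) {M : ℕ} (hM : 0 < M)
    (he : 0 < e) (hMd : M * e ≤ d) (X W : Finset V) (hX : d ≤ X.card)
    (hXn : 2 * X.card ≤ Fintype.card V) (hMX : 2 * M ≤ X.card) (hW : 2 * e * W.card < X.card) :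
    ∃ S ⊆ X, M * S.card ≤ X.card ∧ X.card ≤ 2 * e * ((X ∪ W)ᶜ ∩ nbrs G S).card := by
  obtain ⟨S, hSX, hSc, hS, hor⟩ :=
    exists_maximal_sparse_source (G := G) X (X ∪ W)ᶜ M (X.card / M) hM
  refine ⟨S, hSX, ?_, ?_⟩
  · exact (Nat.mul_le_mul_left M hSc).trans (Nat.mul_div_le _ _)
  rcases hor with heq | hst
  -- The cap is reached: M⌊|X|/M⌋ > |X| − M ≥ |X|/2.
  · rw [heq] at hS
    have h1 := Nat.div_add_mod X.card M
    have h2 := Nat.mod_lt X.card hM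
    nlinarith
  -- The cap is not reached: if S saw too little, `X` and the unseen set `Z` would cover enough for
  -- edge expansion to give more than d|X|/e edges, whereas each vertex of `X` sends fewer than M ≤
  -- d/e edges to `Z`.
  · by_contra! hlt
    set Z := (X ∪ W)ᶜ \ nbrs G S with hZ
    have hdisj : Disjoint X Z := by
      rw [Finset.disjoint_left]
      intro v hv hv'
      simp only [hZ, mem_sdiff, mem_compl, mem_union] at hv'
      tauto
    have hcompl : (X ∪ Z)ᶜ ⊆ W ∪ ((X ∪ W)ᶜ ∩ nbrs G S) := by
      intro v
      simp only [hZ, mem_sdiff, mem_compl, mem_union, mem_inter]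
      tauto
    have hc := (card_le_card hcompl).trans (card_union_le _ _)
    have := hG X Z hdisj hX hXn (by nlinarith)
    have hsum : ∑ x ∈ X, (Z.filter (G.Adj x)).card ≤ ∑ x ∈ X, M :=
      sum_le_sum fun x hx => (hst x hx).le
    rw [sum_const, smul_eq_mul] at hsum
    have h3 : e * ∑ x ∈ X, (Z.filter (G.Adj x)).card ≤ e * (X.card * M) :=
      Nat.mul_le_mul_left _ hsum
    nlinarith

theorem sum_card_filter_adj_comm (X Z : Finset V) :
    ∑ x ∈ X, (Z.filter (G.Adj x)).card = ∑ z ∈ Z, (X.filter (G.Adj z)).card := by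
  simp only [card_filter]
  rw [sum_comm]
  simp only [G.adj_comm]

/-- The set of vertices not yet reached shrinks when a small part of the reached set is used. -/
theorem EdgeExpanding.exists_sparse_cover {d e : ℕ} (hG : EdgeExpanding G d e) {M : ℕ} (hM : 0 < M)
    (R W : Finset V) (δ : ℕ) (hδd : d ≤ δ)
    (hδ : e * M * Fintype.card V ≤ d * δ) (hW : 2 * e * W.card < δ)
    (hRn : 2 * (R ∪ W)ᶜ.card ≤ Fintype.card V) :
    ∃ S ⊆ R \ W, M * S.card ≤ Fintype.card V ∧
      (((R ∪ W)ᶜ \ nbrs G S).card < δ ∨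
        (2 * e + 1) * ((R ∪ W)ᶜ \ nbrs G S).card ≤ 2 * e * (R ∪ W)ᶜ.card) := by
  obtain ⟨S, hSX, hSc, hS, hor⟩ :=
    exists_maximal_sparse_source (G := G) (R \ W) (R ∪ W)ᶜ M ((R \ W).card + 1) hM
  refine ⟨S, hSX, hS.trans (card_le_univ _), ?_⟩
  -- The cap |R \ W| + 1 is out of reach for a subset, so only the degree alternative survives.
  have hst := hor.resolve_left (by have := card_le_card hSX; omega)
  by_contra! hcon
  obtain ⟨h1, h2⟩ := hcon
  set Y := (R ∪ W)ᶜ with hY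
  set Z := Y \ nbrs G S with hZ
  have hsplit : (Y ∩ nbrs G S).card + Z.card = Y.card := card_inter_add_card_sdiff _ _
  have hdisj : Disjoint Z (R \ W) := by
    rw [Finset.disjoint_left]
    intro v hv hv'
    simp only [hZ, hY, mem_sdiff, mem_compl, mem_union] at hv hv'
    tauto
  have hcompl : (Z ∪ (R \ W))ᶜ ⊆ W ∪ (Y ∩ nbrs G S) := by
    intro v
    simp only [hZ, hY, mem_sdiff, mem_compl, mem_union, mem_inter]
    tauto
  have hc := (card_le_card hcompl).trans (card_union_le _ _)
  -- Expansion is applied from the unreached side, the one of size at most n/2. It gives more than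
  -- d|Z|/e ≥ Mn edges, while fewer than `M` leave each reached vertex.
  have := hG Z (R \ W) hdisj (by omega) (by omega) (by nlinarith)
  rw [sum_card_filter_adj_comm] at this
  have hsum : ∑ x ∈ R \ W, (Z.filter (G.Adj x)).card ≤ ∑ x ∈ R \ W, M :=
    sum_le_sum fun x hx => (hst x hx).le
  rw [sum_const, smul_eq_mul] at hsum
  have hcu : (R \ W).card ≤ Fintype.card V := card_le_univ _
  have h3 : e * ∑ x ∈ R \ W, (Z.filter (G.Adj x)).card ≤ e * (Fintype.card V * M) :=
    Nat.mul_le_mul_left _ (hsum.trans (Nat.mul_le_mul_right _ hcu))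
  have h4 : d * δ ≤ d * Z.card := Nat.mul_le_mul_left _ h1
  nlinarith

end Expansion

/-! ### Reaching most of the graph through small disjoint sets -/

section Reach

variable {V : Type*} [Fintype V] [DecidableEq V] (G : SimpleGraph V) [DecidableRel G.Adj]

/-- There is a walk of length at most `i` from `v` to `A` all of whose vertices, apart from
possibly `v` itself, lie in `U`. -/
def Reach (A U : Finset V) (i : ℕ) (v : V) : Prop :=
  ∃ a ∈ A, ∃ p : G.Walk v a, p.length ≤ i ∧ ∀ z ∈ p.support, z = v ∨ z ∈ U

variable {G}

theorem Reach.mono {A U U' : Finset V} {i j : ℕ} {v : V} (h : Reach G A U i v) (hU : U ⊆ U')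
    (hij : i ≤ j) : Reach G A U' j v := by
  obtain ⟨a, ha, p, hp, hs⟩ := h
  exact ⟨a, ha, p, hp.trans hij, fun z hz => (hs z hz).imp_right fun h => hU h⟩

theorem Reach.of_mem {A U : Finset V} {v : V} (h : v ∈ A) : Reach G A U 0 v :=
  ⟨v, h, SimpleGraph.Walk.nil, by simp, by simp⟩

theorem Reach.step {A U : Finset V} {i : ℕ} {s v : V} (h : Reach G A U i s) (hs : s ∈ U)
    (hsv : G.Adj s v) : Reach G A U (i + 1) v := by
  obtain ⟨a, ha, p, hp, hsup⟩ := h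
  refine ⟨a, ha, SimpleGraph.Walk.cons hsv.symm p, by simpa using hp, ?_⟩
  intro z hz
  rw [SimpleGraph.Walk.support_cons, List.mem_cons] at hz
  rcases hz with rfl | hz
  · exact Or.inl rfl
  · rcases hsup z hz with rfl | h
    · exact Or.inr hs
    · exact Or.inr h

/-- One growth round. Only the sparse source joins the inner vertices, so `U` grows by at most x/M
while the reached set grows by the factor 1 + 1/(4e). Size is measured by a target `x` rather than
by |R|, so that two sets can be kept in step. -/
theorem EdgeExpanding.exists_reach_growth {d e : ℕ} (hG : EdgeExpanding G d e) {M : ℕ} (hM : 0 < M)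
    (he : 0 < e) (hMd : M * e ≤ d) (A R U W : Finset V) (i x : ℕ) (hxR : x ≤ R.card)
    (hxn : 2 * x ≤ Fintype.card V) (hW : (4 * e + 2) * W.card ≤ x) (hdx : 2 * d ≤ x)
    (hMx : 4 * M ≤ x) (hUW : Disjoint U W) (hR : ∀ v ∈ R, Reach G A U i v) :
    ∃ R' U' : Finset V, U ⊆ U' ∧ Disjoint U' W ∧ M * U'.card ≤ M * U.card + x ∧
      (∀ v ∈ R', Reach G A U' (i + 1) v) ∧ (4 * e + 1) * x ≤ 4 * e * R'.card := by
  have hWx : 6 * W.card ≤ x := by nlinarith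
  have hcard : x - W.card ≤ (R \ W).card := by
    have := le_card_sdiff W R
    omega
  -- Trimming to |X| = x − |W| keeps `X` below half of the graph, as expansion requires.
  obtain ⟨X, hXR, hXc⟩ := exists_subset_card_eq hcard
  have hXx : X.card + W.card = x := by omega
  obtain ⟨S, hSX, hS, hgrow⟩ := hG.exists_sparse_source hM he hMd X W (by omega) (by omega)
    (by omega) (by nlinarith)
  refine ⟨X ∪ ((X ∪ W)ᶜ ∩ nbrs G S), U ∪ S, subset_union_left, ?_, ?_, ?_, ?_⟩
  · rw [disjoint_union_left]
    refine ⟨hUW, ?_⟩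
    rw [Finset.disjoint_left]
    intro v hv
    exact (mem_sdiff.1 (hXR (hSX hv))).2
  · have := Nat.mul_le_mul_left M (card_union_le U S)
    rw [Nat.mul_add] at this
    omega
  · intro v hv
    rcases mem_union.1 hv with hv | hv
    · exact (hR v (mem_sdiff.1 (hXR hv)).1).mono subset_union_left (by omega)
    · obtain ⟨s, hs, hsv⟩ := (mem_nbrs G).1 (mem_inter.1 hv).2
      exact ((hR s (mem_sdiff.1 (hXR (hSX hs))).1).mono subset_union_left le_rfl).step
        (mem_union_right _ hs) hsv
  · rw [card_union_of_disjoint]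
    -- The gain (x − |W|)/(2e) pays for the loss of |W| and still leaves x/(4e), because (4e + 2)|W|
    -- ≤ x.
    · nlinarith
    · rw [Finset.disjoint_left]
      intro v hv hv'
      simp only [mem_inter, mem_compl, mem_union] at hv'
      tauto

/-- Two sets grow simultaneously to half of the graph, using disjoint sets of inner vertices. -/
theorem EdgeExpanding.exists_reach_half {d e : ℕ} (hG : EdgeExpanding G d e) {M : ℕ} (hM : 0 < M)
    (he : 0 < e) (hMd : M * e ≤ d) (A B W : Finset V) (D r : ℕ) (hA : D ≤ A.card) (hB : D ≤ B.card)
    (hdD : 2 * d ≤ D) (hMD : 4 * M ≤ D) (hW : 2 * (4 * e + 2) * W.card ≤ D) (hr : 0 < r)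
    (hrM : 2 * (4 * e + 2) * r ≤ M)
    (hrn : Fintype.card V * (4 * e) ^ r ≤ d * (4 * e + 1) ^ r) :
    ∃ RA RB UA UB : Finset V, Disjoint UA UB ∧ Disjoint UA W ∧ Disjoint UB W ∧
      (∀ v ∈ RA, Reach G A UA r v) ∧ (∀ v ∈ RB, Reach G B UB r v) ∧
      Fintype.card V ≤ 2 * RA.card ∧ Fintype.card V ≤ 2 * RB.card ∧
      M * UA.card ≤ r * Fintype.card V ∧ M * UB.card ≤ r * Fintype.card V := by
  -- `x` is a common lower bound for both reached sets; it freezes once it reaches n/2. The bound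
  -- M|U| ≤ ix keeps each inner set negligible against `x`, so that it can be forbidden to the other
  -- side.
  have key : ∀ i ≤ r, ∃ (RA RB UA UB : Finset V) (x : ℕ), Disjoint UA UB ∧ Disjoint UA W ∧
      Disjoint UB W ∧ (∀ v ∈ RA, Reach G A UA i v) ∧ (∀ v ∈ RB, Reach G B UB i v) ∧
      x ≤ RA.card ∧ x ≤ RB.card ∧ D ≤ x ∧ M * UA.card ≤ i * x ∧ M * UB.card ≤ i * x ∧
      (Fintype.card V ≤ 2 * x ∨ (4 * e + 1) ^ i * D ≤ (4 * e) ^ i * x) := by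
    intro i
    induction i with
    | zero =>
      intro _
      refine ⟨A, B, ∅, ∅, D, by simp, by simp, by simp, fun v hv => Reach.of_mem hv,
        fun v hv => Reach.of_mem hv, hA, hB, le_rfl, by simp, by simp, by simp⟩
    | succ i ih =>
      intro hi
      obtain ⟨RA, RB, UA, UB, x, hAB, hAW, hBW, hRA, hRB, hxA, hxB, hDx, hUA, hUB, hor⟩ :=
        ih (by omega)
      by_cases hx : Fintype.card V ≤ 2 * x
      · exact ⟨RA, RB, UA, UB, x, hAB, hAW, hBW, fun v hv => (hRA v hv).mono subset_rfl (by omega),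
          fun v hv => (hRB v hv).mono subset_rfl (by omega), hxA, hxB, hDx,
          hUA.trans (Nat.mul_le_mul_right _ (by omega)),
          hUB.trans (Nat.mul_le_mul_right _ (by omega)), Or.inl hx⟩
      have hor := hor.resolve_left hx
      have small : ∀ U : Finset V, M * U.card ≤ (i + 1) * x → (4 * e + 2) * (W ∪ U).card ≤ x := by
        intro U hU
        have h1 : r * (2 * (4 * e + 2) * U.card) ≤ r * x := by
          calc r * (2 * (4 * e + 2) * U.card) = (2 * (4 * e + 2) * r) * U.card := by ring
            _ ≤ M * U.card := Nat.mul_le_mul_right _ hrM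
            _ ≤ (i + 1) * x := hU
            _ ≤ r * x := Nat.mul_le_mul_right _ hi
        have h2 := Nat.le_of_mul_le_mul_left h1 hr
        have h3 := Nat.mul_le_mul_left (4 * e + 2) (card_union_le W U)
        nlinarith
      obtain ⟨RA', UA', hsA, hdA, hcA, hrA, hgA⟩ := hG.exists_reach_growth hM he hMd A RA UA (W ∪ UB)
        i x hxA (by omega) (small UB (hUB.trans (Nat.mul_le_mul_right _ (by omega)))) (by omega)
        (by omega) (disjoint_union_right.2 ⟨hAW, hAB⟩) hRA
      rw [disjoint_union_right] at hdA
      have hcA' : M * UA'.card ≤ (i + 1) * x := by rw [Nat.add_mul]; omega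
      -- The second side avoids the inner set just enlarged by the first, which keeps the two
      -- disjoint.
      obtain ⟨RB', UB', hsB, hdB, hcB, hrB, hgB⟩ := hG.exists_reach_growth hM he hMd B RB UB (W ∪ UA')
        i x hxB (by omega) (small UA' hcA') (by omega)
        (by omega) (disjoint_union_right.2 ⟨hBW, hdA.2.symm⟩) hRB
      rw [disjoint_union_right] at hdB
      have hcB' : M * UB'.card ≤ (i + 1) * x := by rw [Nat.add_mul]; omega
      have hmin : (4 * e + 1) * x ≤ 4 * e * min RA'.card RB'.card := by
        rcases min_choice RA'.card RB'.card with h | h <;> rw [h] <;> assumption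
      have hxx : x ≤ min RA'.card RB'.card := by
        by_contra! hlt
        nlinarith
      refine ⟨RA', RB', UA', UB', min RA'.card RB'.card, hdB.2.symm, hdA.1, hdB.1, hrA, hrB,
        min_le_left _ _, min_le_right _ _, hDx.trans hxx, hcA'.trans (Nat.mul_le_mul_left _ hxx),
        hcB'.trans (Nat.mul_le_mul_left _ hxx), Or.inr ?_⟩
      calc (4 * e + 1) ^ (i + 1) * D = (4 * e + 1) * ((4 * e + 1) ^ i * D) := by ring
        _ ≤ (4 * e + 1) * ((4 * e) ^ i * x) := Nat.mul_le_mul_left _ hor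
        _ = (4 * e) ^ i * ((4 * e + 1) * x) := by ring
        _ ≤ (4 * e) ^ i * (4 * e * min RA'.card RB'.card) := Nat.mul_le_mul_left _ hmin
        _ = _ := by ring
  obtain ⟨RA, RB, UA, UB, x, hAB, hAW, hBW, hRA, hRB, hxA, hxB, hDx, hUA, hUB, hor⟩ := key r le_rfl
  have hx : Fintype.card V ≤ 2 * x := by
    -- If `x` was never frozen, `r` rounds of growth from D ≥ d already exceed n by `hrn`.
    rcases hor with h | h
    · exact h
    · have hpos : 0 < (4 * e) ^ r := by positivity
      have : (4 * e) ^ r * Fintype.card V ≤ (4 * e) ^ r * x := by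
        calc (4 * e) ^ r * Fintype.card V = Fintype.card V * (4 * e) ^ r := by ring
          _ ≤ d * (4 * e + 1) ^ r := hrn
          _ ≤ (4 * e + 1) ^ r * D := by rw [mul_comm]; exact Nat.mul_le_mul_left _ (by omega)
          _ ≤ _ := h
      have := Nat.le_of_mul_le_mul_left this hpos
      omega
  have hcu : x ≤ Fintype.card V := hxA.trans (card_le_univ _)
  exact ⟨RA, RB, UA, UB, hAB, hAW, hBW, hRA, hRB, by omega, by omega,
    hUA.trans (Nat.mul_le_mul_left _ hcu), hUB.trans (Nat.mul_le_mul_left _ hcu)⟩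

/-- A set that has reached half of the graph goes on to reach nearly everything. -/
theorem EdgeExpanding.exists_reach_cover {d e : ℕ} (hG : EdgeExpanding G d e) {M : ℕ} (hM : 0 < M)
    (A R U W : Finset V) (i r δ : ℕ) (hδd : d ≤ δ)
    (hδ : e * M * Fintype.card V ≤ d * δ) (hW : 2 * e * W.card < δ)
    (hRn : Fintype.card V ≤ 2 * R.card) (hUW : Disjoint U W) (hR : ∀ v ∈ R, Reach G A U i v)
    (hr : (2 * e) ^ r * Fintype.card V < (2 * e + 1) ^ r * δ) :
    ∃ R' U' : Finset V, Disjoint U' W ∧ M * U'.card ≤ M * U.card + r * Fintype.card V ∧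
      (∀ v ∈ R', Reach G A U' (i + r) v) ∧ (R' ∪ W)ᶜ.card < δ := by
  -- Beyond one half, the quantity to follow is the unreached part, which shrinks by the factor
  -- 2e/(2e + 1) in each round until it falls below δ.
  have key : ∀ j, ∃ R' U' : Finset V, Disjoint U' W ∧
      M * U'.card ≤ M * U.card + j * Fintype.card V ∧ Fintype.card V ≤ 2 * R'.card ∧
      (∀ v ∈ R', Reach G A U' (i + j) v) ∧ ((R' ∪ W)ᶜ.card < δ ∨
        (2 * e + 1) ^ j * (R' ∪ W)ᶜ.card ≤ (2 * e) ^ j * Fintype.card V) := by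
    intro j
    induction j with
    | zero => exact ⟨R, U, hUW, by simp, hRn, hR, Or.inr (by simpa using card_le_univ _)⟩
    | succ j ih =>
      obtain ⟨R', U', hd, hc, hn, hre, hor⟩ := ih
      have hcomp : 2 * (R' ∪ W)ᶜ.card ≤ Fintype.card V := by
        rw [card_compl]
        have := card_le_card (subset_union_left (s₁ := R') (s₂ := W))
        omega
      obtain ⟨S, hSR, hS, hor'⟩ := hG.exists_sparse_cover hM R' W δ hδd hδ hW hcomp
      have hset : (R' ∪ (nbrs G S \ W) ∪ W)ᶜ = (R' ∪ W)ᶜ \ nbrs G S := by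
        ext v
        simp only [mem_compl, mem_union, mem_sdiff]
        tauto
      refine ⟨R' ∪ (nbrs G S \ W), U' ∪ S, ?_, ?_, ?_, ?_, ?_⟩
      · rw [disjoint_union_left]
        refine ⟨hd, ?_⟩
        rw [Finset.disjoint_left]
        intro v hv
        exact (mem_sdiff.1 (hSR hv)).2
      · have := Nat.mul_le_mul_left M (card_union_le U' S)
        rw [Nat.mul_add] at this
        rw [Nat.add_mul]
        omega
      · exact hn.trans (Nat.mul_le_mul_left _ (card_le_card subset_union_left))
      · intro v hv
        rcases mem_union.1 hv with hv | hv
        · exact (hre v hv).mono subset_union_left (by omega)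
        · obtain ⟨s, hs, hsv⟩ := (mem_nbrs G).1 (mem_sdiff.1 hv).1
          exact ((hre s (mem_sdiff.1 (hSR hs)).1).mono subset_union_left le_rfl).step
            (mem_union_right _ hs) hsv
      · rw [hset]
        have hle := card_le_card (sdiff_subset (s := (R' ∪ W)ᶜ) (t := nbrs G S))
        rcases hor with hor | hor
        · left; omega
        · refine hor'.imp id fun h => ?_
          calc (2 * e + 1) ^ (j + 1) * ((R' ∪ W)ᶜ \ nbrs G S).card
              = (2 * e + 1) ^ j * ((2 * e + 1) * ((R' ∪ W)ᶜ \ nbrs G S).card) := by ring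
            _ ≤ (2 * e + 1) ^ j * (2 * e * (R' ∪ W)ᶜ.card) := Nat.mul_le_mul_left _ h
            _ = 2 * e * ((2 * e + 1) ^ j * (R' ∪ W)ᶜ.card) := by ring
            _ ≤ 2 * e * ((2 * e) ^ j * Fintype.card V) := Nat.mul_le_mul_left _ hor
            _ = _ := by ring
  obtain ⟨R', U', hd, hc, hn, hre, hor⟩ := key r
  refine ⟨R', U', hd, hc, hre, ?_⟩
  rcases hor with h | h
  · exact h
  · exact Nat.lt_of_mul_lt_mul_left (h.trans_lt hr)

end Reach

/-! ### Paths of exactly prescribed length -/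

theorem isPath_append {V : Type*} {G : SimpleGraph V} {u v w : V} {p : G.Walk u v}
    {q : G.Walk v w} (hp : p.IsPath) (hq : q.IsPath)
    (h : ∀ z ∈ p.support, z ∈ q.support → z = v) : (p.append q).IsPath := by
  rw [SimpleGraph.Walk.isPath_def, SimpleGraph.Walk.support_append]
  have hq' := hq.support_nodup
  rw [← SimpleGraph.Walk.cons_tail_support, List.nodup_cons] at hq'
  refine List.Nodup.append hp.support_nodup hq'.2 ?_
  intro z hz hz'
  have := h z hz (List.mem_of_mem_tail hz')
  subst this
  exact hq'.1 hz'

section Exact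

variable {V : Type*} [Fintype V] [DecidableEq V] {G : SimpleGraph V} [DecidableRel G.Adj]

theorem Reach.exists_isPath {A U : Finset V} {i : ℕ} {v : V} (h : Reach G A U i v) :
    ∃ l ≤ i, ∃ a ∈ A, ∃ p : G.Walk v a, p.IsPath ∧ p.length = l ∧
      ∀ z ∈ p.support, z = v ∨ z ∈ U := by
  obtain ⟨a, ha, p, hp, hs⟩ := h
  exact ⟨_, p.length_bypass_le_length.trans hp, a, ha, p.bypass, p.bypass_isPath, rfl,
    fun z hz => hs z (p.support_bypass_subset_support hz)⟩

/-- A graph of large average degree has a nonempty set inducing large minimum degree. -/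
theorem exists_min_degree_core (H : SimpleGraph V) [DecidableRel H.Adj] (k : ℕ) (S : Finset V)
    (h : 2 * k * S.card < ∑ v ∈ S, (S.filter (H.Adj v)).card) :
    ∃ S' ⊆ S, S'.Nonempty ∧ ∀ v ∈ S', k ≤ (S'.filter (H.Adj v)).card := by
  induction hn : S.card generalizing S with
  | zero =>
    rw [card_eq_zero] at hn
    subst hn
    simp at h
  | succ n ih =>
    by_cases hall : ∀ v ∈ S, k ≤ (S.filter (H.Adj v)).card
    · exact ⟨S, subset_rfl, card_pos.1 (by omega), hall⟩
    push Not at hall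
    obtain ⟨v, hv, hlt⟩ := hall
    have hce := card_erase_of_mem hv
    -- Deleting `v` costs its own degree and one at each neighbour, less than 2k in all, so the
    -- average-degree hypothesis survives.
    have h1 : ∑ u ∈ S, (S.filter (H.Adj u)).card =
        (S.filter (H.Adj v)).card + ∑ u ∈ S.erase v, (S.filter (H.Adj u)).card :=
      (add_sum_erase S _ hv).symm
    have h2 : ∑ u ∈ S.erase v, (S.filter (H.Adj u)).card ≤
        ∑ u ∈ S.erase v, ((S.erase v).filter (H.Adj u)).card +
          ((S.erase v).filter (H.Adj v)).card := by
      rw [card_filter (p := H.Adj v), ← sum_add_distrib]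
      refine sum_le_sum fun u _ => ?_
      by_cases huv : H.Adj v u
      · rw [if_pos huv, filter_erase]
        have := pred_card_le_card_erase (s := S.filter (H.Adj u)) (a := v)
        omega
      · have hnot : v ∉ S.filter (H.Adj u) := fun hmem => huv (mem_filter.1 hmem).2.symm
        rw [if_neg huv, filter_erase, erase_eq_of_notMem hnot, add_zero]
    have h3 : ((S.erase v).filter (H.Adj v)).card ≤ (S.filter (H.Adj v)).card :=
      card_le_card (filter_subset_filter _ (erase_subset _ _))
    obtain ⟨S', hS', hne, hdeg⟩ := ih (S.erase v) (by
      rw [hce]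
      have : 2 * k * S.card = 2 * k * (S.card - 1) + 2 * k := by
        obtain ⟨c, hc⟩ : ∃ c, S.card = c + 1 := ⟨n, hn⟩
        rw [hc]; simp; ring
      omega) (by omega)
    exact ⟨S', hS'.trans (erase_subset _ _), hne, hdeg⟩

/-- The path is extended at its free end `y`: besides `y` it has R < k vertices, so one of the `k`
neighbours of `y` in `S` is new. The other end stays at `x`. -/
theorem exists_path_in_core (H : SimpleGraph V) [DecidableRel H.Adj] {k : ℕ} {S : Finset V}
    (hS : ∀ v ∈ S, k ≤ (S.filter (H.Adj v)).card) {x : V} (hx : x ∈ S) (R : ℕ) (hR : R ≤ k) :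
    ∃ y ∈ S, ∃ p : H.Walk y x, p.IsPath ∧ p.length = R ∧ ∀ z ∈ p.support, z ∈ S := by
  induction R with
  | zero => exact ⟨x, hx, SimpleGraph.Walk.nil, by simp, by simp, by simpa using hx⟩
  | succ R ih =>
    obtain ⟨y, hy, p, hp, hl, hs⟩ := ih (by omega)
    have hcard : (p.support.toFinset.erase y).card < (S.filter (H.Adj y)).card := by
      rw [card_erase_of_mem (by simp), List.toFinset_card_of_nodup hp.support_nodup,
        SimpleGraph.Walk.length_support]
      have := hS y hy
      omega
    obtain ⟨w, hw, hwp⟩ := exists_mem_notMem_of_card_lt_card hcard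
    rw [mem_filter] at hw
    have hwp' : w ∉ p.support := by
      intro h
      exact hwp (mem_erase.2 ⟨hw.2.ne', List.mem_toFinset.2 h⟩)
    refine ⟨w, hw.1, SimpleGraph.Walk.cons hw.2.symm p, ?_, by simp [hl], ?_⟩
    · exact (SimpleGraph.Walk.cons_isPath_iff _ _).2 ⟨hp, hwp'⟩
    · intro z hz
      rw [SimpleGraph.Walk.support_cons, List.mem_cons] at hz
      rcases hz with rfl | hz
      · exact hw.1
      · exact hs z hz

/-- If all vertices of a dense set can be linked to `A` and to `B` through disjoint sets, then there
is a path from `A` to `B` of any prescribed length of the right parity. -/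
theorem exists_path_of_reach (C : G.Coloring Bool) (β : Bool) {A B W UA UB Z : Finset V} {i k T : ℕ}
    (hA : ∀ v ∈ A, C v = β) (hB : ∀ v ∈ B, C v = β) (hUU : Disjoint UA UB) (hUAW : Disjoint UA W)
    (hUBW : Disjoint UB W) (hZW : Disjoint Z W) (hZA : Disjoint Z UA) (hZB : Disjoint Z UB)
    (hrA : ∀ v ∈ Z, Reach G A UA i v) (hrB : ∀ v ∈ Z, Reach G B UB i v)
    (hZ : (i + 1) * (i + 1) * (2 * k * Z.card) < ∑ v ∈ Z, (Z.filter (G.Adj v)).card)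
    (hT : Even T) (hiT : 2 * i ≤ T) (hTk : T < k) :
    ∃ a ∈ A, ∃ b ∈ B, ∃ p : G.Walk a b, p.IsPath ∧ p.length = T ∧ ∀ z ∈ p.support, z ∉ W := by
  classical
  -- The level of v is the length of one chosen path to `A`; outside `Z` it is a dummy 0.
  have hex : ∀ v, ∃ l ≤ i, v ∈ Z → ∃ a ∈ A, ∃ p : G.Walk v a, p.IsPath ∧ p.length = l ∧
      ∀ z ∈ p.support, z = v ∨ z ∈ UA := by
    intro v
    by_cases hv : v ∈ Z
    · obtain ⟨l, hl, h⟩ := (hrA v hv).exists_isPath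
      exact ⟨l, hl, fun _ => h⟩
    · exact ⟨0, by omega, fun h => absurd h hv⟩
  choose h hhi hh using hex
  set E := (Z ×ˢ Z).filter fun p => G.Adj p.1 p.2 with hE
  have hEcard : E.card = ∑ v ∈ Z, (Z.filter (G.Adj v)).card := by
    rw [hE, card_filter, sum_product]
    exact sum_congr rfl fun v _ => (card_filter _ _).symm
  -- Pigeonhole over the (i + 1)² ordered pairs of levels at the ends of an edge.
  obtain ⟨⟨a, b⟩, -, hfib⟩ := exists_lt_card_fiber_of_mul_lt_card_of_maps_to
    (s := E) (t := range (i + 1) ×ˢ range (i + 1)) (f := fun p => (h p.1, h p.2))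
    (n := 2 * k * Z.card) (by
      intro p _
      have h1 := hhi p.1
      have h2 := hhi p.2
      simp only [mem_product, mem_range]
      omega) (by rw [card_product, card_range, hEcard]; exact hZ)
  let H : SimpleGraph V :=
    { Adj := fun u v => G.Adj u v ∧ ((h u = a ∧ h v = b) ∨ (h u = b ∧ h v = a))
      symm := ⟨fun u v huv => ⟨huv.1.symm, by tauto⟩⟩
      loopless := ⟨fun u hu => G.loopless.irrefl u hu.1⟩ }
  have hHG : H ≤ G := fun u v huv => huv.1
  have hsum : 2 * k * Z.card < ∑ v ∈ Z, (Z.filter (H.Adj v)).card := by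
    refine hfib.trans_le ?_
    have : ∑ v ∈ Z, (Z.filter (H.Adj v)).card = ((Z ×ˢ Z).filter fun p => H.Adj p.1 p.2).card := by
      rw [card_filter, sum_product]
      exact sum_congr rfl fun v _ => card_filter _ _
    rw [this]
    refine card_le_card fun p hp => ?_
    simp only [hE, mem_filter, Prod.mk.injEq] at hp ⊢
    exact ⟨hp.1.1, hp.1.2, Or.inl hp.2⟩
  obtain ⟨S, hSZ, ⟨x, hx⟩, hcore⟩ := exists_min_degree_core H k Z hsum
  have hnbr : ∀ v ∈ S, ∃ w ∈ S, H.Adj v w := by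
    intro v hv
    have := hcore v hv
    obtain ⟨w, hw⟩ := card_pos.1 (show 0 < (S.filter (H.Adj v)).card by omega)
    exact ⟨w, (mem_filter.1 hw).1, (mem_filter.1 hw).2⟩
  have hlev : ∀ v ∈ S, h v = a ∨ h v = b := by
    intro v hv
    obtain ⟨w, _, hw⟩ := hnbr v hv
    exact hw.2.imp (fun h => h.1) fun h => h.1
  -- All of `A` has colour β, so colour determines the parity of the level.
  have hpar : ∀ v ∈ S, (Even (h v) ↔ (C v ↔ β)) := by
    intro v hv
    obtain ⟨a', ha', p, _, hpl, _⟩ := hh v (hSZ hv)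
    rw [← hpl, C.even_length_iff_congr p, hA a' ha']
  have hai : a ≤ i := by
    obtain ⟨w, _, hw⟩ := hnbr x hx
    rcases hw.2 with hw | hw
    · exact hw.1 ▸ hhi x
    · exact hw.2 ▸ hhi w
  obtain ⟨g, hgi, b', hb', q, hq, hql, hqs⟩ := (hrB x (hSZ hx)).exists_isPath
  -- The B-tail at `x` has length `g`, and the A-tail at `y` should have length `a`; the core path
  -- supplies the remaining T − g − a.
  obtain ⟨y, hy, z, hz, hzl, hzs⟩ := exists_path_in_core H hcore hx (T - g - a) (by omega)
  obtain ⟨a', ha', p, hp, hpl, hps⟩ := hh y (hSZ hy)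
  set z' : G.Walk y x := z.mapLe hHG with hz'
  have hz'p : z'.IsPath := by simpa [hz'] using hz
  have hz'l : z'.length = T - g - a := by simpa [hz'] using hzl
  have hz's : ∀ v ∈ z'.support, v ∈ S := by simpa [hz'] using hzs
  have hzq : (z'.append q).IsPath := by
    refine isPath_append hz'p hq fun v hv hv' => (hqs v hv').resolve_right fun hvU => ?_
    exact (Finset.disjoint_left.1 hZB) (hSZ (hz's v hv)) hvU
  have hfull : (p.reverse.append (z'.append q)).IsPath := by
    refine isPath_append hp.reverse hzq fun v hv hv' => ?_
    rw [SimpleGraph.Walk.support_reverse, List.mem_reverse] at hv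
    refine (hps v hv).resolve_right fun hvU => ?_
    rw [SimpleGraph.Walk.mem_support_append_iff] at hv'
    rcases hv' with hv' | hv'
    · exact (Finset.disjoint_left.1 hZA) (hSZ (hz's v hv')) hvU
    · rcases hqs v hv' with rfl | hvB
      · exact (Finset.disjoint_left.1 hZA) (hSZ hx) hvU
      · exact (Finset.disjoint_left.1 hUU) hvU hvB
  have hlen : (p.reverse.append (z'.append q)).length = h y + ((T - g - a) + g) := by
    simp [hpl, hz'l, hql]
  -- Otherwise `y` has level b ≠ a and a core neighbour `w` of level `a`. Their colours differ, so a
  -- and b have opposite parity. But the assembled path has length b + T − a and joins two vertices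
  -- of colour β, so this length is even, and `T` is even too.
  have hya : h y = a := by
    rcases hlev y hy with h1 | h1
    · exact h1
    by_contra hne
    obtain ⟨w, hwS, hw⟩ := hnbr y hy
    have hwa : h w = a := by
      rcases hw.2 with h2 | h2
      · exact absurd h2.1 hne
      · exact h2.2
    have hC : C y ≠ C w := C.valid hw.1
    have e1 := hpar y hy
    have e2 := hpar w hwS
    have e3 := C.even_length_iff_congr (p.reverse.append (z'.append q))
    rw [hA a' ha', hB b' hb', hlen] at e3
    have e4 : Even (h y + (T - g - a + g)) := by simpa using e3
    rw [h1] at e1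
    rw [hwa] at e2
    rw [h1, show b + (T - g - a + g) = b + (T - a) by omega, Nat.even_add,
      Nat.even_sub (by omega)] at e4
    have e5 : Even b ↔ Even a := by simpa only [hT, true_iff] using e4
    rw [e1, e2] at e5
    revert hC e5
    cases C y <;> cases C w <;> cases β <;> simp
  refine ⟨a', ha', b', hb', _, hfull, by rw [hlen, hya]; omega, ?_⟩
  intro v hv
  have hSW : ∀ v ∈ S, v ∉ W := fun v hv => (Finset.disjoint_left.1 hZW) (hSZ hv)
  rw [SimpleGraph.Walk.mem_support_append_iff, SimpleGraph.Walk.mem_support_append_iff,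
    SimpleGraph.Walk.support_reverse, List.mem_reverse] at hv
  rcases hv with hv | hv | hv
  · rcases hps v hv with rfl | h
    · exact hSW _ hy
    · exact (Finset.disjoint_left.1 hUAW) h
  · exact hSW _ (hz's v hv)
  · rcases hqs v hv with rfl | h
    · exact hSW _ hx
    · exact (Finset.disjoint_left.1 hUBW) h

end Exact

/-! ### The numerical regime and the connecting lemma -/

/-- The relations between the numerical parameters: `n` vertices, minimum degree `d`, expansion
rate `1 / e`, target length scale `m`, number of growth rounds `r`. -/
structure Regime (n d e m r : ℕ) : Prop where
  m_large : 1000 ≤ m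
  e_pos : 0 < e
  e_le : e ≤ m
  r_pos : 0 < r
  r_le : 4 * r ≤ m
  pow_le_d : m ^ 200 ≤ d
  mul_pow_le_n : d * m ^ 300 ≤ n
  rounds : n * (4 * e) ^ r ≤ d * (4 * e + 1) ^ r

/-- `R` and `S` are the sets reached from the two sides. Each is controlled only off its own
forbidden set, `W ∪ U'` and `W ∪ U` respectively, so those sets enter the cover as well. -/
theorem compl_reached_subset {V : Type*} [Fintype V] [DecidableEq V] (R S W U U' U'' : Finset V) :
    ((R ∩ S) \ (W ∪ U ∪ U''))ᶜ ⊆ ((W ∪ U) ∪ (U' ∪ U'')) ∪ ((R ∪ (W ∪ U'))ᶜ ∪ (S ∪ (W ∪ U))ᶜ) := by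
  intro v
  simp only [mem_compl, mem_sdiff, mem_union, mem_inter]
  tauto

section Connect

variable {V : Type*} [Fintype V] [DecidableEq V] {G : SimpleGraph V} [DecidableRel G.Adj]

/-- Large sets on the same side of the bipartition are joined by a path of any prescribed even
length in a wide range, which avoids a small forbidden set. -/
theorem EdgeExpanding.exists_path_of_length {d e m r : ℕ} (hG : EdgeExpanding G d e)
    (hreg : Regime (Fintype.card V) d e m r) (C : G.Coloring Bool) (β : Bool)
    {A B W : Finset V} {D T : ℕ} (hA : ∀ v ∈ A, C v = β) (hB : ∀ v ∈ B, C v = β)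
    (hAD : D ≤ A.card) (hBD : D ≤ B.card) (hdD : 2 * d ≤ D) (hW : W.card * m ^ 4 ≤ D)
    (hT : Even T) (hmT : m ≤ T) (hTm : T < m ^ 4) :
    ∃ a ∈ A, ∃ b ∈ B, ∃ p : G.Walk a b, p.IsPath ∧ p.length = T ∧ ∀ z ∈ p.support, z ∉ W := by
  obtain ⟨hm, he, hem, hr, hrm, hmd, hdn, hrounds⟩ := hreg
  set n := Fintype.card V with hn
  have hm0 : 0 < m := by omega
  have hpow : ∀ j ≤ 200, m ^ j ≤ d := fun j hj => (Nat.pow_le_pow_right hm0 hj).trans hmd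
  have hd10 : 1000 * m ^ 13 ≤ d :=
    le_trans (by rw [pow_succ' m 13]; exact Nat.mul_le_mul_right _ hm) (hpow 14 (by norm_num))
  have hd0 : 0 < d := lt_of_lt_of_le (by positivity) (hpow 0 (by norm_num))
  have hn4 : d * m ^ 4 ≤ n :=
    le_trans (Nat.mul_le_mul_left _ (Nat.pow_le_pow_right hm0 (by norm_num))) hdn
  have hp2 : 0 < m ^ 2 := by positivity
  have hp4 : 0 < m ^ 4 := by positivity
  have hAn : A.card ≤ n := card_le_univ _
  have hm12 : m ^ 2 * 1000 ≤ m ^ 3 := by rw [pow_succ m 2]; exact Nat.mul_le_mul_left _ hm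
  have hm13 : m * 1000 ≤ m ^ 2 := by rw [pow_two]; exact Nat.mul_le_mul_left _ hm
  have hm34 : m ^ 3 * 1000 ≤ m ^ 4 := by rw [pow_succ m 3]; exact Nat.mul_le_mul_left _ hm
  have hm46 : m ^ 4 ≤ m ^ 6 := Nat.pow_le_pow_right hm0 (by norm_num)
  have hm613 : m ^ 7 ≤ m ^ 13 := Nat.pow_le_pow_right hm0 (by norm_num)
  have hm67 : m ^ 6 ≤ m ^ 7 := Nat.pow_le_pow_right hm0 (by norm_num)
  have hm913 : m ^ 9 ≤ m ^ 13 := Nat.pow_le_pow_right hm0 (by norm_num)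
  have hMe : m ^ 6 * e ≤ d := by
    calc m ^ 6 * e ≤ m ^ 6 * m := Nat.mul_le_mul_left _ hem
      _ = m ^ 7 := by ring
      _ ≤ d := by omega
  have hWD : 2 * (4 * e + 2) * W.card ≤ D := by
    refine le_trans ?_ hW
    rw [mul_comm]
    exact Nat.mul_le_mul_left _ (by omega)
  have hrM : 2 * (4 * e + 2) * r ≤ m ^ 6 := by
    calc 2 * (4 * e + 2) * r ≤ (m * 1000) * m := Nat.mul_le_mul (by omega) (by omega)
      _ ≤ m ^ 2 * m := Nat.mul_le_mul_right _ hm13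
      _ = m ^ 3 := by ring
      _ ≤ m ^ 6 := Nat.pow_le_pow_right hm0 (by norm_num)
  -- With M = m⁶ the inner sets have size at most rn/m⁶, while Me ≤ m⁷ is still far below d.
  obtain ⟨RA, RB, UA, UB, hUU, hAW, hBW, hRA, hRB, hRAn, hRBn, hUAc, hUBc⟩ :=
    hG.exists_reach_half (M := m ^ 6) (by positivity) he hMe A B W D r hAD hBD hdD
      (by omega) hWD hr hrM hrounds
  rw [← hn] at hRAn hRBn hUAc hUBc
  obtain ⟨δ, hδ⟩ : ∃ δ, δ = n / m ^ 2 := ⟨_, rfl⟩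
  have hδ1 : m ^ 2 * δ ≤ n := hδ ▸ Nat.mul_div_le _ _
  have hm2n : 2 * m ^ 2 ≤ n := by
    have : 2 * m ^ 2 ≤ d * m ^ 4 := by
      calc 2 * m ^ 2 ≤ m ^ 4 := by omega
        _ ≤ d * m ^ 4 := Nat.le_mul_of_pos_left _ hd0
    omega
  have hδ2 : n ≤ 2 * (m ^ 2 * δ) := by
    have h1 := Nat.lt_mul_div_succ n hp2
    rw [← hδ, Nat.mul_add] at h1
    omega
  have hdδ : d * 1000 ≤ δ := by
    have h1 : m ^ 2 * (d * m ^ 2) ≤ m ^ 2 * (2 * δ) := by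
      calc m ^ 2 * (d * m ^ 2) = d * m ^ 4 := by ring
        _ ≤ n := hn4
        _ ≤ _ := hδ2
        _ = _ := by ring
    have h2 := Nat.le_of_mul_le_mul_left h1 hp2
    have h3 : d * 2000 ≤ d * m ^ 2 := Nat.mul_le_mul_left _ (by omega)
    linarith only [h2, h3]
  have heMn : e * m ^ 6 * n ≤ d * δ := by
    calc e * m ^ 6 * n ≤ (m * m ^ 6) * (2 * (m ^ 2 * δ)) :=
          Nat.mul_le_mul (Nat.mul_le_mul_right _ hem) hδ2
      _ = (2 * m ^ 9) * δ := by ring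
      _ ≤ d * δ := Nat.mul_le_mul_right _ (by omega)
  -- The covering rate 1 + 1/(2e) exceeds the growth rate 1 + 1/(4e) and d < δ, so the same number
  -- `r` of rounds suffices.
  have hcov : (2 * e) ^ r * n < (2 * e + 1) ^ r * δ := by
    have h1 : 2 ^ r * ((2 * e) ^ r * n) ≤ 2 ^ r * ((2 * e + 1) ^ r * d) := by
      calc 2 ^ r * ((2 * e) ^ r * n) = n * (4 * e) ^ r := by
            rw [← mul_assoc, ← mul_pow]; ring_nf
        _ ≤ d * (4 * e + 1) ^ r := hrounds
        _ ≤ d * (2 * (2 * e + 1)) ^ r :=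
            Nat.mul_le_mul_left _ (Nat.pow_le_pow_left (by omega) _)
        _ = 2 ^ r * ((2 * e + 1) ^ r * d) := by rw [mul_pow]; ring
    have h2 := Nat.le_of_mul_le_mul_left h1 (by positivity)
    exact h2.trans_lt (Nat.mul_lt_mul_of_pos_left (by omega) (by positivity))
  have hWn : m ^ 4 * W.card ≤ n := by rw [mul_comm]; omega
  have hUsmall : ∀ U : Finset V, m ^ 6 * U.card ≤ 2 * (r * n) → m ^ 4 * U.card ≤ n := by
    intro U hU
    have h1 : m * (m ^ 5 * U.card) ≤ m * n := by
      calc m * (m ^ 5 * U.card) = m ^ 6 * U.card := by ring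
        _ ≤ 2 * (r * n) := hU
        _ = (2 * r) * n := by ring
        _ ≤ m * n := Nat.mul_le_mul_right _ (by omega)
    have h2 := Nat.le_of_mul_le_mul_left h1 hm0
    exact le_trans (Nat.mul_le_mul_right _ (Nat.pow_le_pow_right hm0 (by norm_num))) h2
  have hW'small : ∀ U : Finset V, m ^ 4 * U.card ≤ n → 2 * e * (W ∪ U).card < δ := by
    intro U hU
    have h1 : m ^ 4 * (W ∪ U).card ≤ 4 * (m ^ 2 * δ) := by
      have := Nat.mul_le_mul_left (m ^ 4) (card_union_le W U)
      rw [Nat.mul_add] at this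
      omega
    have h2 : m ^ 2 * (m ^ 2 * (W ∪ U).card) ≤ m ^ 2 * (4 * δ) := by
      calc m ^ 2 * (m ^ 2 * (W ∪ U).card) = m ^ 4 * (W ∪ U).card := by ring
        _ ≤ 4 * (m ^ 2 * δ) := h1
        _ = _ := by ring
    have h3 := Nat.le_of_mul_le_mul_left h2 hp2
    have h4 : 10 * (2 * e) ≤ m ^ 2 := by omega
    have h5 := Nat.mul_le_mul_right (W ∪ U).card h4
    have h6 : 10 * (2 * e) * (W ∪ U).card = 10 * (2 * e * (W ∪ U).card) := by ring
    omega
  have hUB' := hUsmall UB (by omega)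
  obtain ⟨RA', UA', hdA, hcA, hrA, hbA⟩ := hG.exists_reach_cover (M := m ^ 6) (by positivity)
    A RA UA (W ∪ UB) r r δ (by omega) heMn (hW'small UB hUB') hRAn
    (disjoint_union_right.2 ⟨hAW, hUU⟩) hRA hcov
  rw [disjoint_union_right] at hdA
  rw [← hn] at hcA
  have hUA' := hUsmall UA' (by omega)
  obtain ⟨RB', UB', hdB, hcB, hrB, hbB⟩ := hG.exists_reach_cover (M := m ^ 6) (by positivity)
    B RB UB (W ∪ UA') r r δ (by omega) heMn (hW'small UA' hUA') hRBn
    (disjoint_union_right.2 ⟨hBW, hdA.2.symm⟩) hRB hcov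
  rw [disjoint_union_right] at hdB
  rw [← hn] at hcB
  have hUB'' := hUsmall UB' (by omega)
  set Z := (RA' ∩ RB') \ (W ∪ UA' ∪ UB') with hZ
  have hZc : m ^ 2 * Zᶜ.card ≤ 6 * n := by
    have hsub : Zᶜ ⊆ ((W ∪ UA') ∪ (UB ∪ UB')) ∪ ((RA' ∪ (W ∪ UB))ᶜ ∪ (RB' ∪ (W ∪ UA'))ᶜ) :=
      compl_reached_subset _ _ _ _ _ _
    have h1 := card_le_card hsub
    have h2 := card_union_le ((W ∪ UA') ∪ (UB ∪ UB')) ((RA' ∪ (W ∪ UB))ᶜ ∪ (RB' ∪ (W ∪ UA'))ᶜ)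
    have h3 := card_union_le (W ∪ UA') (UB ∪ UB')
    have h4 := card_union_le W UA'
    have h5 := card_union_le UB UB'
    have h6 := card_union_le (RA' ∪ (W ∪ UB))ᶜ (RB' ∪ (W ∪ UA'))ᶜ
    have h7 : Zᶜ.card ≤ W.card + UA'.card + UB.card + UB'.card + δ + δ := by omega
    have h8 : ∀ c, m ^ 4 * c ≤ n → m ^ 2 * c ≤ n := fun c hc =>
      le_trans (Nat.mul_le_mul_right _ (Nat.pow_le_pow_right hm0 (by norm_num))) hc
    have h9 := Nat.mul_le_mul_left (m ^ 2) h7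
    simp only [Nat.mul_add] at h9
    have := h8 _ hWn
    have := h8 _ hUA'
    have := h8 _ hUB'
    have := h8 _ hUB''
    omega
  have heZ : e * Zᶜ.card * 100 ≤ n := by
    have h1 : m * (e * Zᶜ.card) ≤ 6 * n := by
      calc m * (e * Zᶜ.card) ≤ m * (m * Zᶜ.card) :=
            Nat.mul_le_mul_left _ (Nat.mul_le_mul_right _ hem)
        _ = m ^ 2 * Zᶜ.card := by ring
        _ ≤ _ := hZc
    have h2 := Nat.mul_le_mul_right (e * Zᶜ.card) hm
    omega
  have hZcard : Z.card + Zᶜ.card = n := card_add_card_compl Z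
  have hZe : Zᶜ.card ≤ e * Zᶜ.card := Nat.le_mul_of_pos_left _ he
  have hnd : d * 1000 ≤ n :=
    le_trans (Nat.mul_le_mul_left _ (by omega)) hn4
  -- As |Zᶜ| is tiny compared with n/e, expansion of a third of the graph inside `Z` gives more than
  -- d|X|/e edges within `Z`.
  obtain ⟨X, hXZ, hXc⟩ := exists_subset_card_eq (show n / 3 ≤ Z.card by omega)
  have hXZc : X ∪ (Z \ X) = Z := union_sdiff_of_subset hXZ
  have hedges := hG X (Z \ X) disjoint_sdiff (by omega) (by omega) (by
    rw [hXZc]; omega)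
  have hsum : ∑ x ∈ X, ((Z \ X).filter (G.Adj x)).card ≤ ∑ v ∈ Z, (Z.filter (G.Adj v)).card :=
    (sum_le_sum fun x _ => card_le_card (filter_subset_filter _ sdiff_subset)).trans
      (sum_le_sum_of_subset hXZ)
  -- There are 2r + 1 possible levels and the core degree is to be m⁴; all losses together are of
  -- order m⁷, well below d.
  have hdense : (2 * r + 1) * (2 * r + 1) * (2 * m ^ 4 * Z.card) <
      ∑ v ∈ Z, (Z.filter (G.Adj v)).card := by
    have h1 : (2 * r + 1) * (2 * r + 1) * (2 * m ^ 4 * Z.card) * e ≤ d * X.card := by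
      calc (2 * r + 1) * (2 * r + 1) * (2 * m ^ 4 * Z.card) * e
          ≤ m * m * (2 * m ^ 4 * (4 * X.card)) * m := by gcongr <;> omega
        _ = 8 * m ^ 7 * X.card := by ring
        _ ≤ d * X.card := Nat.mul_le_mul_right _ (by omega)
    have h2 := Nat.mul_le_mul_left e hsum
    exact Nat.lt_of_mul_lt_mul_right (a := e) (by
      rw [mul_comm (∑ v ∈ Z, (Z.filter (G.Adj v)).card)]
      omega)
  have hZdis : Disjoint Z (W ∪ UA' ∪ UB') := sdiff_disjoint
  rw [disjoint_union_right, disjoint_union_right] at hZdis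
  have hrr : r + r = 2 * r := by ring
  rw [hrr] at hrA hrB
  exact exists_path_of_reach C β hA hB hdB.2.symm hdA.1 hdB.1 hZdis.1.1 hZdis.1.2 hZdis.2
    (fun v hv => hrA v (mem_inter.1 (mem_sdiff.1 hv).1).1)
    (fun v hv => hrB v (mem_inter.1 (mem_sdiff.1 hv).1).2) hdense hT (by omega) hTm

end Connect

/-! ### Dependent random choice and subdivisions with paths of length two -/

theorem sum_card_filter_comm {α β : Type*} (A : Finset α) (B : Finset β) (P : α → β → Prop)
    [∀ a b, Decidable (P a b)] :
    ∑ a ∈ A, (B.filter fun b => P a b).card = ∑ b ∈ B, (A.filter fun a => P a b).card := by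
  simp only [card_filter]
  exact sum_comm

/-- The averaging estimate behind dependent random choice. -/
theorem mul_le_sub_of_moments {u x y c b t : ℝ} (hu : 0 < u) (hx : 0 < x) (hy : 0 < y) (hb : 0 ≤ b)
    (hlow : u * x ≤ y * c) (hup : y ^ 10 * b ≤ u ^ 2 * x) (hyu : 2 * u ≤ y ^ 9)
    (ht : 2 * t * y ≤ u) : x * t ≤ c - b := by
  -- The bad pairs cost at most half of the guaranteed total `u * x`, and the target `t` costs at
  -- most the other half.
  have h1 : 2 * u * (y * b) ≤ y ^ 9 * (y * b) := mul_le_mul_of_nonneg_right hyu (by positivity)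
  have h2 : y ^ 9 * (y * b) = y ^ 10 * b := by ring
  have h3 : 2 * y * b ≤ u * x := by
    refine le_of_mul_le_mul_left ?_ hu
    nlinarith
  have h4 : 2 * t * y * x ≤ u * x := mul_le_mul_of_nonneg_right ht hx.le
  refine le_of_mul_le_mul_left ?_ hy
  nlinarith

section DependentRandomChoice

variable {V : Type*} [Fintype V] [DecidableEq V] {G : SimpleGraph V} [DecidableRel G.Adj]

set_option maxHeartbeats 1000000 in
/-- Dependent random choice: if every vertex of `X` is joined to a `1 / c` fraction of `U`, then `U`
has a fairly large subset in which every pair has many common neighbours in `X`. -/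
theorem exists_subset_large_codegree (X U : Finset V) (c τ t : ℕ) (hc : 2 ≤ c) (hX : X.Nonempty)
    (hU : U.Nonempty) (hdeg : ∀ x ∈ X, U.card ≤ c * (U.filter (G.Adj x)).card)
    (hτ : τ * c ^ 10 ≤ X.card) (ht : 2 * (2 * t) ^ 9 * c ^ 9 ≤ U.card ^ 8) :
    ∃ T ⊆ U, T.card = t ∧ ∀ u ∈ T, ∀ v ∈ T, u ≠ v →
      τ ≤ (X.filter fun x => G.Adj x u ∧ G.Adj x v).card := by
  have hUpos : 0 < U.card := card_pos.2 hU
  have hXpos : 0 < X.card := card_pos.2 hX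
  -- The number q + 1 of samples is the least that makes bad pairs rare; minimality keeps c^(q+1)
  -- small enough for the common neighbourhood to remain large.
  have hex : ∃ r, 2 * U.card ≤ (c ^ 9) ^ r := by
    obtain ⟨r, hr⟩ := pow_unbounded_of_one_lt (2 * U.card)
      (Nat.one_lt_pow (by norm_num) (by omega : 1 < c) : 1 < c ^ 9)
    exact ⟨r, hr.le⟩
  obtain ⟨q, hq⟩ : ∃ q, Nat.find hex = q + 1 := by
    refine ⟨Nat.find hex - 1, ?_⟩
    have : Nat.find hex ≠ 0 := by
      intro h
      have := Nat.find_spec hex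
      rw [h, pow_zero] at this
      omega
    omega
  have hq1 : 2 * U.card ≤ (c ^ 9) ^ (q + 1) := hq ▸ Nat.find_spec hex
  have hq2 : (c ^ 9) ^ q < 2 * U.card := not_le.1 (Nat.find_min hex (by omega))
  have hlarge : 2 * t * c ^ (q + 1) ≤ U.card := by
    refine (Nat.pow_le_pow_iff_left (n := 9) (by norm_num)).1 ?_
    calc (2 * t * c ^ (q + 1)) ^ 9 = (2 * t) ^ 9 * c ^ 9 * (c ^ 9) ^ q := by ring
      _ ≤ (2 * t) ^ 9 * c ^ 9 * (2 * U.card) := Nat.mul_le_mul_left _ hq2.le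
      _ = (2 * (2 * t) ^ 9 * c ^ 9) * U.card := by ring
      _ ≤ U.card ^ 8 * U.card := Nat.mul_le_mul_right _ ht
      _ = U.card ^ 9 := by ring
  set tuples := Fintype.piFinset fun _ : Fin (q + 1) => X with htup
  have htupcard : tuples.card = X.card ^ (q + 1) := by simp [htup]
  set common : (Fin (q + 1) → V) → Finset V := fun f => U.filter fun u => ∀ i, G.Adj (f i) u
    with hcommon
  set codeg : V × V → ℕ := fun p => (X.filter fun x => G.Adj x p.1 ∧ G.Adj x p.2).card with hcodeg
  set bad : Finset (V × V) := (U ×ˢ U).filter fun p => codeg p < τ with hbad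
  set badIn : (Fin (q + 1) → V) → Finset (V × V) := fun f =>
    bad.filter fun p => ∀ i, G.Adj (f i) p.1 ∧ G.Adj (f i) p.2 with hbadIn
  have count : ∀ P : V → Prop, ∀ [DecidablePred P],
      (tuples.filter fun f => ∀ i, P (f i)).card = (X.filter P).card ^ (q + 1) := by
    intro P _
    have : (tuples.filter fun f => ∀ i, P (f i)) =
        Fintype.piFinset fun _ : Fin (q + 1) => X.filter P := by
      ext f
      simp only [htup, mem_filter, Fintype.mem_piFinset]
      exact ⟨fun h i => ⟨h.1 i, h.2 i⟩, fun h => ⟨fun i => (h i).1, fun i => (h i).2⟩⟩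
    rw [this]
    simp
  have hsumcommon : ∑ f ∈ tuples, (common f).card =
      ∑ u ∈ U, (X.filter fun x => G.Adj x u).card ^ (q + 1) := by
    rw [hcommon, sum_card_filter_comm tuples U fun f u => ∀ i, G.Adj (f i) u]
    exact sum_congr rfl fun u _ => count fun x => G.Adj x u
  have hsumbad : ∑ f ∈ tuples, (badIn f).card = ∑ p ∈ bad, codeg p ^ (q + 1) := by
    rw [hbadIn, sum_card_filter_comm tuples bad fun f p => ∀ i, G.Adj (f i) p.1 ∧ G.Adj (f i) p.2]
    exact sum_congr rfl fun p _ => count fun x => G.Adj x p.1 ∧ G.Adj x p.2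
  have hcpos : (0 : ℝ) < c := by exact_mod_cast (by omega : 0 < c)
  have hUr : (0 : ℝ) < U.card := by exact_mod_cast hUpos
  have hXr : (0 : ℝ) < X.card := by exact_mod_cast hXpos
  have hlow : (U.card : ℝ) * X.card ^ (q + 1) ≤
      c ^ (q + 1) * ∑ f ∈ tuples, ((common f).card : ℝ) := by
    have h1 : (X.card * U.card : ℝ) ≤ c * ∑ u ∈ U, ((X.filter fun x => G.Adj x u).card : ℝ) := by
      have h2 : ∑ x ∈ X, (U.filter (G.Adj x)).card =
          ∑ u ∈ U, (X.filter fun x => G.Adj x u).card := sum_card_filter_comm X U G.Adj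
      have h3 : X.card * U.card ≤ c * ∑ u ∈ U, (X.filter fun x => G.Adj x u).card := by
        rw [← h2, mul_sum, ← smul_eq_mul, ← sum_const]
        exact sum_le_sum hdeg
      exact_mod_cast h3
    -- Convexity: the expected common neighbourhood is smallest when all degrees into `X` are equal.
    have h4 := pow_sum_div_card_le_sum_pow (s := U)
      (f := fun u => ((X.filter fun x => G.Adj x u).card : ℝ)) (fun _ _ => by positivity) q
    rw [div_le_iff₀ (by positivity)] at h4
    have h5 : ∑ f ∈ tuples, ((common f).card : ℝ) =
        ∑ u ∈ U, ((X.filter fun x => G.Adj x u).card : ℝ) ^ (q + 1) := by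
      exact_mod_cast hsumcommon
    rw [h5]
    have h6 := pow_le_pow_left₀ (by positivity) h1 (q + 1)
    rw [mul_pow, mul_pow] at h6
    have h7 := mul_le_mul_of_nonneg_left h4 (by positivity : (0 : ℝ) ≤ (c : ℝ) ^ (q + 1))
    have h8 := h6.trans h7
    have hUq : (0 : ℝ) < (U.card : ℝ) ^ q := by positivity
    refine le_of_mul_le_mul_right ?_ hUq
    calc (U.card : ℝ) * X.card ^ (q + 1) * U.card ^ q = X.card ^ (q + 1) * U.card ^ (q + 1) := by
          ring
      _ ≤ _ := h8
      _ = _ := by ring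
  have hup : (c : ℝ) ^ (10 * (q + 1)) * ∑ f ∈ tuples, ((badIn f).card : ℝ) ≤
      U.card ^ 2 * X.card ^ (q + 1) := by
    have h1 : c ^ (10 * (q + 1)) * ∑ f ∈ tuples, (badIn f).card ≤ U.card ^ 2 * X.card ^ (q + 1) := by
      rw [hsumbad]
      calc c ^ (10 * (q + 1)) * ∑ p ∈ bad, codeg p ^ (q + 1)
          ≤ c ^ (10 * (q + 1)) * ∑ p ∈ bad, τ ^ (q + 1) := by
            -- A bad pair survives one sample with probability at most τ/|X| ≤ c⁻¹⁰.
            refine Nat.mul_le_mul_left _ (sum_le_sum fun p hp => Nat.pow_le_pow_left ?_ _)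
            exact (mem_filter.1 hp).2.le
        _ = bad.card * (τ * c ^ 10) ^ (q + 1) := by
            rw [sum_const, smul_eq_mul, mul_pow, pow_mul]; ring
        _ ≤ U.card ^ 2 * X.card ^ (q + 1) := by
            refine Nat.mul_le_mul ?_ (Nat.pow_le_pow_left hτ _)
            refine (card_filter_le _ _).trans ?_
            rw [card_product, pow_two]
    exact_mod_cast h1
  have hmain : (tuples.card : ℝ) * t ≤
      ∑ f ∈ tuples, (((common f).card : ℝ) - (badIn f).card) := by
    rw [sum_sub_distrib, htupcard]
    push_cast
    refine mul_le_sub_of_moments hUr (pow_pos hXr _) (pow_pos hcpos (q + 1))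
      (sum_nonneg fun _ _ => Nat.cast_nonneg _) hlow ?_ ?_ ?_
    · rw [← pow_mul, mul_comm (q + 1) 10]
      exact hup
    · rw [← pow_mul, mul_comm (q + 1) 9, pow_mul]
      exact_mod_cast hq1
    · exact_mod_cast hlarge
  have htne : tuples.Nonempty := by
    rw [← card_pos, htupcard]
    positivity
  obtain ⟨f, hf, hft⟩ := exists_le_of_sum_le (s := tuples) (f := fun _ => (t : ℝ))
    (g := fun f => ((common f).card : ℝ) - (badIn f).card) htne (by
      rw [sum_const, nsmul_eq_mul]; exact hmain)
  have hft' : t + (badIn f).card ≤ (common f).card := by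
    have : (t : ℝ) + (badIn f).card ≤ (common f).card := by linarith
    exact_mod_cast this
  -- Diagonal pairs may count as bad; they are discarded before the first entry of each remaining
  -- bad pair is deleted.
  set bad' := (badIn f).filter fun p => p.1 ≠ p.2 with hbad'
  have hle : t ≤ (common f \ (bad'.image Prod.fst)).card := by
    have h1 := le_card_sdiff (bad'.image Prod.fst) (common f)
    have h2 : (bad'.image Prod.fst).card ≤ (badIn f).card :=
      card_image_le.trans (card_filter_le _ _)
    omega
  obtain ⟨T, hT, hTc⟩ := exists_subset_card_eq hle
  refine ⟨T, fun u hu => (mem_filter.1 (mem_sdiff.1 (hT hu)).1).1, hTc, fun u hu v hv huv => ?_⟩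
  by_contra! hlt
  have hu' := mem_sdiff.1 (hT hu)
  have hv' := mem_sdiff.1 (hT hv)
  refine hu'.2 (mem_image.2 ⟨(u, v), ?_, rfl⟩)
  rw [hcommon, mem_filter] at hu' hv'
  rw [hbad', mem_filter, hbadIn, mem_filter, hbad, mem_filter, mem_product]
  exact ⟨⟨⟨⟨hu'.1.1, hv'.1.1⟩, hlt⟩, fun i => ⟨hu'.1.2 i, hv'.1.2 i⟩⟩, huv⟩

/-- Pairwise large codegrees give a subdivision all of whose paths have length two. -/
theorem containsTK_one_of_codegree (X T : Finset V) (t : ℕ) (hXT : Disjoint X T) (hT : T.card = t)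
    (h : ∀ u ∈ T, ∀ v ∈ T, u ≠ v → t * t ≤ (X.filter fun x => G.Adj x u ∧ G.Adj x v).card) :
    ContainsTK G t 1 := by
  let ce : Fin t ≃ T := (T.equivFinOfCardEq hT).symm
  let c : Fin t ↪ V := ce.toEmbedding.trans (Function.Embedding.subtype _)
  have hcT : ∀ i, c i ∈ T := fun i => (ce i).2
  let ι := {p : Fin t × Fin t // p.1 < p.2}
  let S : ι → Finset V := fun p => X.filter fun x => G.Adj x (c p.1.1) ∧ G.Adj x (c p.1.2)
  -- Hall's condition is immediate: there are at most t² pairs, and each one already has t²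
  -- candidates.
  have hhall : ∀ s : Finset ι, s.card ≤ (s.biUnion S).card := by
    intro s
    rcases s.eq_empty_or_nonempty with rfl | ⟨p, hp⟩
    · simp
    · have h1 : s.card ≤ t * t := by
        refine (card_le_univ s).trans ((Fintype.card_subtype_le _).trans ?_)
        simp
      have h2 := h (c p.1.1) (hcT _) (c p.1.2) (hcT _) (fun he => p.2.ne (c.injective he))
      exact h1.trans (h2.trans (card_le_card (subset_biUnion_of_mem S hp)))
  obtain ⟨f, hf, hfS⟩ := (all_card_le_biUnion_card_iff_exists_injective S).1 hhall
  have hfX : ∀ p, f p ∈ X := fun p => (mem_filter.1 (hfS p)).1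
  have hne : ∀ p i, f p ≠ c i := fun p i he =>
    (Finset.disjoint_left.1 hXT) (hfX p) (he ▸ hcT i)
  refine ⟨c, fun i j hij => .cons (mem_filter.1 (hfS ⟨(i, j), hij⟩)).2.1.symm
    (.cons (mem_filter.1 (hfS ⟨(i, j), hij⟩)).2.2 .nil), ?_, ?_, ?_⟩
  · intro i j hij
    have h1 : c i ≠ c j := fun he => hij.ne (c.injective he)
    have h2 := hne ⟨(i, j), hij⟩
    refine ⟨?_, by simp⟩
    rw [SimpleGraph.Walk.isPath_def]
    simp [h1, h2, (h2 i).symm]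
  · intro i j hij k hk
    simp only [SimpleGraph.Walk.support_cons, SimpleGraph.Walk.support_nil, List.mem_cons,
      List.not_mem_nil, or_false] at hk
    rcases hk with hk | hk | hk
    · exact Or.inl (c.injective hk)
    · exact absurd hk.symm (hne _ _)
    · exact Or.inr (c.injective hk)
  · intro i j hij i' j' hij' hpair v hv hvi hvj hv'
    simp only [SimpleGraph.Walk.support_cons, SimpleGraph.Walk.support_nil, List.mem_cons,
      List.not_mem_nil, or_false, hvi, hvj, false_or] at hv hv'
    subst hv
    rcases hv' with hv' | hv' | hv'
    · exact hne _ _ hv'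
    · have := hf hv'
      simp only [ι, Subtype.mk.injEq] at this
      exact hpair this
    · exact hne _ _ hv'

end DependentRandomChoice

/-! ### Stars away from small sets -/

section Stars

variable {V : Type*} [Fintype V] [DecidableEq V] {G : SimpleGraph V} [DecidableRel G.Adj]

/-- Unless there is a subdivision with all paths of length two, no small set absorbs half of the
neighbourhood of every vertex on a large side. -/
theorem exists_star_avoiding {d e m r t : ℕ} (hreg : Regime (Fintype.card V) d e m r)
    (hdeg : ∀ v, d ≤ G.degree v) (Side : Finset V) (hSide : Fintype.card V ≤ 2 * Side.card)
    (ht : t ^ 2 ≤ 4 * d * m ^ 2) (hno : ¬ ContainsTK G t 1) (U : Finset V)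
    (hU : U.card ≤ d * m ^ 22) :
    ∃ v ∈ Side, v ∉ U ∧ d ≤ 2 * (G.neighborFinset v \ U).card := by
  obtain ⟨hm, he, hem, hr, hrm, hmd, hdn, hrounds⟩ := hreg
  have hm0 : 0 < m := by omega
  have hd0 : 0 < d := lt_of_lt_of_le (by positivity) hmd
  by_contra! hcon
  refine hno ?_
  have hXU : Disjoint (Side \ U) U := sdiff_disjoint
  -- If no star avoids `U`, every vertex of the side outside `U` has at least d/2 ≥ |U|/(2m²²)
  -- neighbours in `U`, the density needed for dependent random choice.
  have hxdeg : ∀ x ∈ Side \ U, d ≤ 2 * (U.filter (G.Adj x)).card := by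
    intro x hx
    rw [mem_sdiff] at hx
    have h1 := hcon x hx.1 hx.2
    have h2 := hdeg x
    rw [← G.card_neighborFinset_eq_degree] at h2
    have h3 : (G.neighborFinset x ∩ U).card + (G.neighborFinset x \ U).card =
        (G.neighborFinset x).card := card_inter_add_card_sdiff _ _
    have h4 : G.neighborFinset x ∩ U = U.filter (G.Adj x) := by
      ext v; simp [and_comm]
    rw [h4] at h3
    omega
  have hn1 : d * m ^ 22 * 4 ≤ Fintype.card V := by
    refine le_trans ?_ hdn
    rw [mul_assoc]
    refine Nat.mul_le_mul_left _ ?_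
    calc m ^ 22 * 4 ≤ m ^ 22 * m := Nat.mul_le_mul_left _ (by omega)
      _ = m ^ 23 := by ring
      _ ≤ m ^ 300 := Nat.pow_le_pow_right hm0 (by norm_num)
  have hXc : Fintype.card V ≤ 4 * (Side \ U).card := by
    have := le_card_sdiff U Side
    omega
  have hVpos : 0 < Fintype.card V :=
    lt_of_lt_of_le (by positivity) hdn
  have hXne : (Side \ U).Nonempty := card_pos.1 (by omega)
  have hdU : d ≤ 2 * U.card := by
    obtain ⟨x, hx⟩ := hXne
    exact (hxdeg x hx).trans (Nat.mul_le_mul_left _ (card_filter_le _ _))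
  have hUne : U.Nonempty := card_pos.1 (by omega)
  have hnum1 : t * t * (2 * m ^ 22) ^ 10 ≤ (Side \ U).card := by
    refine Nat.le_of_mul_le_mul_left (c := 4) ?_ (by norm_num)
    calc 4 * (t * t * (2 * m ^ 22) ^ 10) = 4096 * t ^ 2 * m ^ 220 := by ring
      _ ≤ 4096 * (4 * d * m ^ 2) * m ^ 220 := by gcongr
      _ = d * (16384 * m ^ 222) := by ring
      _ ≤ d * (m ^ 2 * m ^ 222) := by
          gcongr
          nlinarith
      _ = d * m ^ 224 := by ring
      _ ≤ d * m ^ 300 := Nat.mul_le_mul_left _ (Nat.pow_le_pow_right hm0 (by norm_num))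
      _ ≤ Fintype.card V := hdn
      _ ≤ _ := hXc
  have hnum2 : 2 * (2 * t) ^ 9 * (2 * m ^ 22) ^ 9 ≤ U.card ^ 8 := by
    have h1 : (2 * t) ^ 2 ≤ 16 * d * m ^ 2 := by nlinarith
    -- The exponent 9 is raised to 10 so that only t² is needed; the loss is absorbed because |U|⁸ ≥
    -- (d/2)⁸ against d⁵.
    have h2 : (2 * t) ^ 9 ≤ (16 * d * m ^ 2) ^ 5 := by
      rcases Nat.eq_zero_or_pos t with h0 | h0
      · subst h0; simp
      calc (2 * t) ^ 9 ≤ (2 * t) ^ 10 := Nat.pow_le_pow_right (by omega) (by norm_num)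
        _ = ((2 * t) ^ 2) ^ 5 := by ring
        _ ≤ _ := Nat.pow_le_pow_left h1 _
    have h3 : 2 ^ 38 ≤ m ^ 4 := by
      calc 2 ^ 38 ≤ 1000 ^ 4 := by norm_num
        _ ≤ m ^ 4 := Nat.pow_le_pow_left hm 4
    have h4 : m ^ 212 ≤ d ^ 3 := by
      calc m ^ 212 ≤ m ^ 600 := Nat.pow_le_pow_right hm0 (by norm_num)
        _ = (m ^ 200) ^ 3 := by rw [← pow_mul]
        _ ≤ d ^ 3 := Nat.pow_le_pow_left hmd 3
    refine Nat.le_of_mul_le_mul_left (c := 2 ^ 8) ?_ (by norm_num)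
    calc 2 ^ 8 * (2 * (2 * t) ^ 9 * (2 * m ^ 22) ^ 9)
        ≤ 2 ^ 8 * (2 * (16 * d * m ^ 2) ^ 5 * (2 * m ^ 22) ^ 9) := by gcongr
      _ = d ^ 5 * (2 ^ 38 * m ^ 208) := by ring
      _ ≤ d ^ 5 * (m ^ 4 * m ^ 208) := by gcongr
      _ = d ^ 5 * m ^ 212 := by ring
      _ ≤ d ^ 5 * d ^ 3 := Nat.mul_le_mul_left _ h4
      _ = d ^ 8 := by ring
      _ ≤ (2 * U.card) ^ 8 := Nat.pow_le_pow_left hdU _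
      _ = 2 ^ 8 * U.card ^ 8 := by ring
  obtain ⟨T, hTU, hTc, hT⟩ := exists_subset_large_codegree (G := G) (Side \ U) U (2 * m ^ 22) (t * t) t
    (by have : 0 < m ^ 22 := by positivity
        omega) hXne hUne (by
      intro x hx
      calc U.card ≤ d * m ^ 22 := hU
        _ ≤ 2 * (U.filter (G.Adj x)).card * m ^ 22 := Nat.mul_le_mul_right _ (hxdeg x hx)
        _ = _ := by ring) hnum1 hnum2
  exact containsTK_one_of_codegree (Side \ U) T t (hXU.mono_right hTU) hTc hT

/-- A family of pairwise disjoint stars, with leaf sets of prescribed size, avoiding a given set. -/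
theorem exists_disjoint_stars {L : ℕ} {Side W : Finset V} {q : ℕ} (hne : Nonempty V)
    (N k : ℕ) (hsup : ∀ U : Finset V, U.card ≤ L → ∃ v ∈ Side, v ∉ U ∧
      q ≤ (G.neighborFinset v \ U).card) (hk : k ≤ q) (hL : W.card + N * (k + 1) ≤ L) :
    ∃ (c : ℕ → V) (leaf : ℕ → Finset V), (∀ i < N, c i ∈ Side ∧ c i ∉ W ∧
        leaf i ⊆ G.neighborFinset (c i) ∧ (leaf i).card = k ∧ Disjoint (leaf i) W) ∧
      ∀ j < N, ∀ i < j, Disjoint (insert (c i) (leaf i)) (insert (c j) (leaf j)) := by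
  obtain ⟨f, hf1, hf2⟩ := exists_greedy_sequence (α := V × Finset V) N
    (fun _ s => s.1 ∈ Side ∧ s.1 ∉ W ∧ s.2 ⊆ G.neighborFinset s.1 ∧ s.2.card = k ∧ Disjoint s.2 W)
    (fun s s' => Disjoint (insert s.1 s.2) (insert s'.1 s'.2)) (by
      intro j hj f hf _
      set U := W ∪ (range j).biUnion fun i => insert (f i).1 (f i).2 with hU
      have hUc : U.card ≤ L := by
        refine le_trans ((card_union_le _ _).trans (Nat.add_le_add_left ?_ _)) hL
        refine (card_biUnion_le_card_mul _ _ (k + 1) fun i hi => ?_).trans ?_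
        · have := card_insert_le (f i).1 (f i).2
          rw [(hf i (mem_range.1 hi)).2.2.2.1] at this
          exact this
        · rw [card_range]
          exact Nat.mul_le_mul_right _ hj.le
      obtain ⟨v, hv, hvU, hdeg⟩ := hsup U hUc
      obtain ⟨l, hl, hlc⟩ := exists_subset_card_eq (hk.trans hdeg)
      have hlU : ∀ x ∈ l, x ∉ U := fun x hx => (mem_sdiff.1 (hl hx)).2
      refine ⟨(v, l), ⟨hv, fun h => hvU (mem_union_left _ h),
        fun x hx => (mem_sdiff.1 (hl hx)).1, hlc, ?_⟩, ?_⟩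
      · rw [Finset.disjoint_left]
        exact fun x hx h => hlU x hx (mem_union_left _ h)
      · intro i hi
        rw [Finset.disjoint_right]
        intro x hx hx'
        have hxU : x ∈ U := mem_union_right _ (mem_biUnion.2 ⟨i, mem_range.2 hi, hx'⟩)
        rcases mem_insert.1 hx with rfl | hx
        · exact hvU hxU
        · exact hlU x hx hxU)
  exact ⟨fun i => (f i).1, fun i => (f i).2, hf1, hf2⟩

end Stars

/-! ### Links between stars, and hubs -/

/-- A path together with two labels for its ends. -/
structure Link {V : Type*} (G : SimpleGraph V) where
  i : ℕ
  j : ℕ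
  a : V
  b : V
  walk : G.Walk a b

/-- A vertex with walks to `s` further vertices, each of which comes with a set of leaves. -/
structure Hub {V : Type*} (G : SimpleGraph V) (s : ℕ) where
  root : V
  tip : Fin s → V
  walk : ∀ p, G.Walk root (tip p)
  leaf : Fin s → Finset V

section Hubs

variable {V : Type*} [Fintype V] [DecidableEq V] {G : SimpleGraph V} [DecidableRel G.Adj]

/-- The walks of the hub are paths of length `r` that share only the root, and the leaves are
disjoint sets of `k` neighbours of the tips. -/
structure Hub.IsProper {s : ℕ} (H : Hub G s) (r k : ℕ) : Prop where
  isPath : ∀ p, (H.walk p).IsPath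
  length : ∀ p, (H.walk p).length = r
  eq_root : ∀ p q, p ≠ q → ∀ z ∈ (H.walk p).support, z ∈ (H.walk q).support → z = H.root
  leaf_subset : ∀ p, H.leaf p ⊆ G.neighborFinset (H.tip p)
  leaf_card : ∀ p, (H.leaf p).card = k
  leaf_disjoint : ∀ p q, p ≠ q → Disjoint (H.leaf p) (H.leaf q)

/-- The vertices on the walks of a hub. -/
def Hub.inner {s : ℕ} (H : Hub G s) : Finset V :=
  univ.biUnion fun p => (H.walk p).support.toFinset

theorem Hub.mem_inner {s : ℕ} {H : Hub G s} {z : V} (p : Fin s) (hz : z ∈ (H.walk p).support) :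
    z ∈ H.inner :=
  mem_biUnion.2 ⟨p, mem_univ _, List.mem_toFinset.2 hz⟩

theorem Hub.IsProper.card_inner_le {s r k : ℕ} {H : Hub G s} (hH : H.IsProper r k) :
    H.inner.card ≤ s * (r + 1) := by
  have := card_biUnion_le_card_mul (univ : Finset (Fin s))
    (fun p => (H.walk p).support.toFinset) (r + 1) (fun p _ => by
      refine (List.toFinset_card_le _).trans ?_
      rw [SimpleGraph.Walk.length_support, hH.length p])
  simpa [Hub.inner] using this

theorem card_biUnion_of_disjoint_leaves {J : Finset ℕ} {leaf : ℕ → Finset V} {k : ℕ}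
    (hc : ∀ i ∈ J, (leaf i).card = k) (hd : ∀ j ∈ J, ∀ i < j, Disjoint (leaf i) (leaf j)) :
    (J.biUnion leaf).card = J.card * k := by
  rw [card_biUnion, sum_congr rfl hc, sum_const, smul_eq_mul]
  intro i hi j hj hij
  rcases lt_or_gt_of_ne hij with h | h
  · exact hd j hj i h
  · exact (hd i hi j h).symm

/-- Many disjoint paths of the same length between two families of stars, no star of the second
family being used twice. -/
theorem EdgeExpanding.exists_links {d e m r : ℕ} (hG : EdgeExpanding G d e)
    (hreg : Regime (Fintype.card V) d e m r) (C : G.Coloring Bool) (β : Bool) [Nonempty V]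
    {cA cB : ℕ → V} {lA lB : ℕ → Finset V} {NA NB kA kB Q D T : ℕ} {W : Finset V}
    (hA : ∀ i < NA, C (cA i) = β ∧ lA i ⊆ G.neighborFinset (cA i) ∧ (lA i).card = kA)
    (hB : ∀ i < NB, C (cB i) = β ∧ lB i ⊆ G.neighborFinset (cB i) ∧ (lB i).card = kB)
    (hAd : ∀ j < NA, ∀ i < j, Disjoint (lA i) (lA j))
    (hBd : ∀ j < NB, ∀ i < j, Disjoint (lB i) (lB j))
    (hdD : 2 * d ≤ D) (hDA : D + (W.card + (NA + NB) + Q * (T + 1)) ≤ NA * kA)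
    (hDB : D + (W.card + (NA + NB) + Q * (T + 1)) ≤ (NB - Q) * kB)
    (hD : (W.card + (NA + NB) + Q * (T + 1)) * m ^ 4 ≤ D)
    (hT : Even T) (hmT : m ≤ T) (hTm : T < m ^ 4) :
    ∃ f : ℕ → Link G, (∀ q < Q, (f q).i < NA ∧ (f q).j < NB ∧ (f q).a ∈ lA (f q).i ∧
        (f q).b ∈ lB (f q).j ∧ (f q).walk.IsPath ∧ (f q).walk.length = T ∧
        ∀ z ∈ (f q).walk.support, z ∉ W ∧ (∀ i < NA, z ≠ cA i) ∧ ∀ i < NB, z ≠ cB i) ∧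
      ∀ q < Q, ∀ q' < q, (f q').j ≠ (f q).j ∧
        ∀ z ∈ (f q').walk.support, z ∉ (f q).walk.support := by
  have hside : ∀ (c : ℕ → V) (l : ℕ → Finset V) (i : ℕ), C (c i) = β →
      l i ⊆ G.neighborFinset (c i) → ∀ v ∈ l i, C v = !β := by
    intro c l i hc hl v hv
    have hadj := (G.mem_neighborFinset _ _).1 (hl hv)
    have := C.valid hadj
    rw [hc] at this
    revert this
    cases C v <;> cases β <;> simp
  have : Nonempty (Link G) := by
    obtain ⟨v⟩ := ‹Nonempty V›
    exact ⟨⟨0, 0, v, v, .nil⟩⟩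
  refine exists_greedy_sequence (α := Link G) Q
    (fun _ x => x.i < NA ∧ x.j < NB ∧ x.a ∈ lA x.i ∧
        x.b ∈ lB x.j ∧ x.walk.IsPath ∧ x.walk.length = T ∧
        ∀ z ∈ x.walk.support, z ∉ W ∧ (∀ i < NA, z ≠ cA i) ∧ ∀ i < NB, z ≠ cB i)
    (fun x y => x.j ≠ y.j ∧ ∀ z ∈ x.walk.support, z ∉ y.walk.support) ?_
  intro q hq f hf _
  set P := (range q).biUnion fun i => (f i).walk.support.toFinset with hP
  set F := W ∪ ((range NA).image cA ∪ (range NB).image cB) ∪ P with hF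
  have hFc : F.card ≤ W.card + (NA + NB) + Q * (T + 1) := by
    refine (card_union_le _ _).trans (Nat.add_le_add ((card_union_le _ _).trans
      (Nat.add_le_add_left ((card_union_le _ _).trans (Nat.add_le_add ?_ ?_)) _)) ?_)
    · exact card_image_le.trans (card_range _).le
    · exact card_image_le.trans (card_range _).le
    · refine (card_biUnion_le_card_mul _ _ (T + 1) fun i hi => ?_).trans ?_
      · refine (List.toFinset_card_le _).trans ?_
        rw [SimpleGraph.Walk.length_support, (hf i (mem_range.1 hi)).2.2.2.2.2.1]
      · rw [card_range]
        exact Nat.mul_le_mul_right _ hq.le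
  -- Stars of the second family not yet used; at least NB − Q of them remain throughout.
  set J := range NB \ (range q).image fun i => (f i).j with hJ
  have hJc : NB - Q ≤ J.card := by
    have h1 : (range NB).card - ((range q).image fun i => (f i).j).card ≤ J.card :=
      le_card_sdiff _ _
    have h2 : ((range q).image fun i => (f i).j).card ≤ q := card_image_le.trans (card_range _).le
    rw [card_range] at h1
    omega
  have hJN : ∀ j ∈ J, j < NB := fun j hj => mem_range.1 (mem_sdiff.1 hj).1
  have hAcard := card_biUnion_of_disjoint_leaves (J := range NA) (leaf := lA) (k := kA)
    (fun i hi => (hA i (mem_range.1 hi)).2.2) fun j hj => hAd j (mem_range.1 hj)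
  have hBcard := card_biUnion_of_disjoint_leaves (J := J) (leaf := lB) (k := kB)
    (fun i hi => (hB i (hJN i hi)).2.2) fun j hj => hBd j (hJN j hj)
  rw [card_range] at hAcard
  have hJk := Nat.mul_le_mul_right kB hJc
  obtain ⟨a, ha, b, hb, p, hp, hpl, hpF⟩ := hG.exists_path_of_length hreg C (!β)
    (A := (range NA).biUnion lA \ F) (B := J.biUnion lB \ F) (W := F) (D := D) (T := T)
    (by
      intro v hv
      obtain ⟨i, hi, hvi⟩ := mem_biUnion.1 (mem_sdiff.1 hv).1
      have := hA i (mem_range.1 hi)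
      exact hside cA lA i this.1 this.2.1 v hvi)
    (by
      intro v hv
      obtain ⟨i, hi, hvi⟩ := mem_biUnion.1 (mem_sdiff.1 hv).1
      have := hB i (hJN i hi)
      exact hside cB lB i this.1 this.2.1 v hvi)
    (by
      have := le_card_sdiff F ((range NA).biUnion lA)
      omega)
    (by
      have := le_card_sdiff F (J.biUnion lB)
      omega)
    hdD ((Nat.mul_le_mul_right _ hFc).trans hD) hT hmT hTm
  obtain ⟨i, hi, hai⟩ := mem_biUnion.1 (mem_sdiff.1 ha).1
  obtain ⟨j, hj, hbj⟩ := mem_biUnion.1 (mem_sdiff.1 hb).1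
  refine ⟨⟨i, j, a, b, p⟩, ⟨mem_range.1 hi, hJN j hj, hai, hbj, hp, hpl, ?_⟩, ?_⟩
  · intro z hz
    have hzF := hpF z hz
    rw [hF, mem_union, mem_union, mem_union] at hzF
    push Not at hzF
    refine ⟨hzF.1.1, ?_, ?_⟩
    · intro i hi he
      exact hzF.1.2.1 (mem_image.2 ⟨i, mem_range.2 hi, he.symm⟩)
    · intro i hi he
      exact hzF.1.2.2 (mem_image.2 ⟨i, mem_range.2 hi, he.symm⟩)
  · intro i' hi'
    refine ⟨?_, ?_⟩
    · intro he
      exact (mem_sdiff.1 hj).2 (mem_image.2 ⟨i', mem_range.2 hi', he⟩)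
    · intro z hz hz'
      exact hpF z hz' (mem_union_right _
        (mem_biUnion.2 ⟨i', mem_range.2 hi', List.mem_toFinset.2 hz⟩))

/-- A hub assembled from links that start in the same star. -/
theorem exists_hub_of_links {cA cB : ℕ → V} {lA lB : ℕ → Finset V} {NA NB k Q T s : ℕ}
    {W : Finset V} {f : ℕ → Link G} {S : Finset ℕ} {i : ℕ} (hi : i < NA)
    (hA : ∀ i < NA, cA i ∉ W ∧ lA i ⊆ G.neighborFinset (cA i))
    (hB : ∀ i < NB, cB i ∉ W ∧ lB i ⊆ G.neighborFinset (cB i) ∧ (lB i).card = k)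
    (hBd : ∀ j < NB, ∀ i < j, Disjoint (insert (cB i) (lB i)) (insert (cB j) (lB j)))
    (hAB : ∀ i < NA, ∀ j < NB, cA i ≠ cB j)
    (hf : ∀ q < Q, (f q).i < NA ∧ (f q).j < NB ∧ (f q).a ∈ lA (f q).i ∧
        (f q).b ∈ lB (f q).j ∧ (f q).walk.IsPath ∧ (f q).walk.length = T ∧
        ∀ z ∈ (f q).walk.support, z ∉ W ∧ (∀ i < NA, z ≠ cA i) ∧ ∀ i < NB, z ≠ cB i)
    (hf' : ∀ q < Q, ∀ q' < q, (f q').j ≠ (f q).j ∧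
        ∀ z ∈ (f q').walk.support, z ∉ (f q).walk.support)
    (hS : S.card = s) (hSQ : ∀ q ∈ S, q < Q ∧ (f q).i = i) :
    ∃ H : Hub G s, H.IsProper (T + 2) k ∧ Disjoint H.inner W ∧ H.root = cA i := by
  let g : Fin s ↪o ℕ := S.orderEmbOfFin hS
  have hgS : ∀ p, g p ∈ S := fun p => S.orderEmbOfFin_mem hS p
  have hgQ : ∀ p, g p < Q := fun p => (hSQ _ (hgS p)).1
  have hgj : ∀ p, (f (g p)).j < NB := fun p => (hf _ (hgQ p)).2.1
  have hadjA : ∀ p, G.Adj (cA i) (f (g p)).a := by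
    intro p
    have h1 := (hf _ (hgQ p)).2.2.1
    rw [(hSQ _ (hgS p)).2] at h1
    exact (G.mem_neighborFinset _ _).1 ((hA i hi).2 h1)
  have hadjB : ∀ p, G.Adj (f (g p)).b (cB (f (g p)).j) := by
    intro p
    have h1 := (hf _ (hgQ p)).2.2.2.1
    exact ((G.mem_neighborFinset _ _).1 ((hB _ (hgj p)).2.1 h1)).symm
  have hdisj : ∀ p q, p ≠ q → (f (g p)).j ≠ (f (g q)).j ∧
      ∀ z ∈ (f (g p)).walk.support, z ∉ (f (g q)).walk.support := by
    intro p q hpq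
    rcases lt_or_gt_of_ne (fun h => hpq (g.injective h) : g p ≠ g q) with h | h
    · exact hf' _ (hgQ q) _ h
    · have := hf' _ (hgQ p) _ h
      exact ⟨this.1.symm, fun z hz hz' => this.2 z hz' hz⟩
  have hBB : ∀ p q, p ≠ q →
      Disjoint (insert (cB (f (g p)).j) (lB (f (g p)).j))
        (insert (cB (f (g q)).j) (lB (f (g q)).j)) := by
    intro p q hpq
    rcases lt_or_gt_of_ne (hdisj p q hpq).1 with h | h
    · exact hBd _ (hgj q) _ h
    · exact (hBd _ (hgj p) _ h).symm
  -- An edge from the root to a leaf, the link, and an edge from a leaf to the centre of the second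
  -- star give length T + 2. The second star supplies the leaves of the tip.
  let H : Hub G s :=
    { root := cA i
      tip := fun p => cB (f (g p)).j
      walk := fun p => .cons (hadjA p) ((f (g p)).walk.concat (hadjB p))
      leaf := fun p => lB (f (g p)).j }
  have hsupp : ∀ p z, z ∈ (H.walk p).support ↔
      z = cA i ∨ z ∈ (f (g p)).walk.support ∨ z = cB (f (g p)).j := by
    intro p z
    simp [H, SimpleGraph.Walk.support_concat]
  have hav : ∀ p, ∀ z ∈ (f (g p)).walk.support,
      z ∉ W ∧ (∀ i < NA, z ≠ cA i) ∧ ∀ i < NB, z ≠ cB i := fun p => (hf _ (hgQ p)).2.2.2.2.2.2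
  refine ⟨H, ⟨?_, ?_, ?_, ?_, ?_, ?_⟩, ?_, rfl⟩
  · intro p
    have h1 : ((f (g p)).walk.concat (hadjB p)).IsPath :=
      (hf _ (hgQ p)).2.2.2.2.1.concat (fun h => (hav p _ h).2.2 _ (hgj p) rfl) _
    refine (SimpleGraph.Walk.cons_isPath_iff _ _).2 ⟨h1, ?_⟩
    rw [SimpleGraph.Walk.support_concat, List.mem_append]
    rintro (h | h)
    · exact (hav p _ h).2.1 _ hi rfl
    · exact hAB i hi _ (hgj p) (by simpa using h)
  · intro p
    simp [H, (hf _ (hgQ p)).2.2.2.2.2.1]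
  · intro p q hpq z hz hz'
    rw [hsupp] at hz hz'
    rcases hz with hz | hz | hz
    · exact hz
    · rcases hz' with hz' | hz' | hz'
      · exact hz'
      · exact absurd hz' ((hdisj p q hpq).2 z hz)
      · exact absurd hz' ((hav p z hz).2.2 _ (hgj q))
    · rcases hz' with hz' | hz' | hz'
      · exact hz'
      · exact absurd hz ((hav q z hz').2.2 _ (hgj p))
      · exfalso
        refine (Finset.disjoint_left.1 (hBB p q hpq)) (a := z) ?_ ?_
        · rw [hz]; exact mem_insert_self _ _
        · rw [hz']; exact mem_insert_self _ _
  · intro p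
    exact (hB _ (hgj p)).2.1
  · intro p
    exact (hB _ (hgj p)).2.2
  · intro p q hpq
    exact (hBB p q hpq).mono (subset_insert _ _) (subset_insert _ _)
  · rw [Finset.disjoint_left]
    intro z hz
    obtain ⟨p, -, hz⟩ := mem_biUnion.1 hz
    rw [List.mem_toFinset, hsupp] at hz
    rcases hz with rfl | hz | rfl
    · exact (hA i hi).1
    · exact (hav p z hz).1
    · exact (hB _ (hgj p)).1

end Hubs

/-! ### Existence of hubs and of hub systems -/

theorem Regime.mul_pow_le {n d e m r t : ℕ} (hreg : Regime n d e m r)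
    (ht : t ^ 2 ≤ 4 * d * m ^ 2) : t * m ^ 20 ≤ d := by
  obtain ⟨hm, -, -, -, -, hmd, -, -⟩ := hreg
  -- Only t² is controlled, so the bound is squared; the extra factor d comes from the power of `m`
  -- below d.
  refine (Nat.pow_le_pow_iff_left (n := 2) (by norm_num)).1 ?_
  have hm0 : 0 < m := by omega
  calc (t * m ^ 20) ^ 2 = t ^ 2 * m ^ 40 := by ring
    _ ≤ 4 * d * m ^ 2 * m ^ 40 := Nat.mul_le_mul_right _ ht
    _ = d * (4 * m ^ 42) := by ring
    _ ≤ d * (m * m ^ 42) := by gcongr; omega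
    _ = d * m ^ 43 := by ring
    _ ≤ d * m ^ 200 := Nat.mul_le_mul_left _ (Nat.pow_le_pow_right hm0 (by norm_num))
    _ ≤ d * d := Nat.mul_le_mul_left _ hmd
    _ = d ^ 2 := by ring

section HubSystem

variable {V : Type*} [Fintype V] [DecidableEq V] {G : SimpleGraph V} [DecidableRel G.Adj]

/-- Unless there is a subdivision with all paths of length two, hubs can be found away from any
small set. -/
theorem EdgeExpanding.exists_hub {d e m r t : ℕ} (hG : EdgeExpanding G d e)
    (hreg : Regime (Fintype.card V) d e m r) (hdeg : ∀ v, d ≤ G.degree v)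
    (C : G.Coloring Bool) (β : Bool)
    (hSide : Fintype.card V ≤ 2 * (univ.filter fun v => C v = β).card)
    (ht1 : d ≤ t ^ 2) (ht2 : t ^ 2 ≤ 4 * d * m ^ 2) (hno : ¬ ContainsTK G t 1) (W : Finset V)
    (hW : W.card ≤ d * m ^ 4) :
    ∃ H : Hub G (2 * t), H.IsProper (4 * m + 2) (2 * t * m ^ 10) ∧ Disjoint H.inner W ∧
      C H.root = β := by
  have htm := hreg.mul_pow_le ht2
  have hreg' := hreg
  obtain ⟨hm, he, hem, hr, hrm, hmd, hdn, hrounds⟩ := hreg'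
  have hm0 : 0 < m := by omega
  have hd0 : 0 < d := lt_of_lt_of_le (by positivity) hmd
  have ht0 : 0 < t := by
    rcases Nat.eq_zero_or_pos t with h | h
    · subst h; simp at ht1; omega
    · exact h
  have hVne : Nonempty V := Fintype.card_pos_iff.1 (lt_of_lt_of_le (by positivity) hdn)
  have hsup : ∀ U : Finset V, U.card ≤ d * m ^ 22 → ∃ v ∈ univ.filter (fun v => C v = β), v ∉ U ∧
      d / 2 ≤ (G.neighborFinset v \ U).card := by
    intro U hU
    obtain ⟨v, hv, hvU, h⟩ := exists_star_avoiding hreg hdeg _ hSide ht2 hno U hU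
    exact ⟨v, hv, hvU, by omega⟩
  have hpm : ∀ a b : ℕ, a < b → 1000 * m ^ a ≤ m ^ b := by
    intro a b hab
    calc 1000 * m ^ a ≤ m * m ^ a := Nat.mul_le_mul_right _ hm
      _ = m ^ (a + 1) := by ring
      _ ≤ m ^ b := Nat.pow_le_pow_right hm0 hab
  have hdpm : ∀ a b : ℕ, a < b → 1000 * (d * m ^ a) ≤ d * m ^ b := by
    intro a b hab
    calc 1000 * (d * m ^ a) = d * (1000 * m ^ a) := by ring
      _ ≤ _ := Nat.mul_le_mul_left _ (hpm a b hab)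
  have htpm : ∀ a b : ℕ, a < b → 1000 * (t * m ^ a) ≤ t * m ^ b := by
    intro a b hab
    calc 1000 * (t * m ^ a) = t * (1000 * m ^ a) := by ring
      _ ≤ _ := Nat.mul_le_mul_left _ (hpm a b hab)
  have hd2 : 1000 ≤ d := by
    have h2 : m ^ 1 ≤ d := (Nat.pow_le_pow_right hm0 (by norm_num)).trans hmd
    rw [pow_one] at h2
    omega
  have hdm0 : d ≤ d * m ^ 4 := Nat.le_mul_of_pos_right _ (by positivity)
  have hk : 2 * t * m ^ 10 ≤ d / 2 := by
    have h1 := htpm 10 20 (by norm_num)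
    have h2 : 2 * t * m ^ 10 = 2 * (t * m ^ 10) := by ring
    omega
  have hLA : W.card + m ^ 9 * (d / 2 + 1) ≤ d * m ^ 22 := by
    have h1 : m ^ 9 * (d / 2 + 1) ≤ m ^ 9 * d := Nat.mul_le_mul_left _ (by omega)
    have h2 : m ^ 9 * d = d * m ^ 9 := by ring
    have h3 := hdpm 9 22 (by norm_num)
    have h4 := hdpm 4 22 (by norm_num)
    omega
  obtain ⟨cA, lA, hA, hAd⟩ := exists_disjoint_stars (W := W) hVne (m ^ 9) (d / 2) hsup le_rfl hLA
  have hWA : (W ∪ (range (m ^ 9)).image cA).card ≤ W.card + m ^ 9 :=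
    (card_union_le _ _).trans (Nat.add_le_add_left (card_image_le.trans (card_range _).le) _)
  have hLB : (W ∪ (range (m ^ 9)).image cA).card + 2 * (m ^ 9 * (2 * t)) * (2 * t * m ^ 10 + 1) ≤
      d * m ^ 22 := by
    have h0 : 1 ≤ t * m ^ 10 := Nat.mul_pos ht0 (by positivity)
    have h1 : 2 * (m ^ 9 * (2 * t)) * (2 * t * m ^ 10 + 1) ≤ 48 * (d * m ^ 21) := by
      calc 2 * (m ^ 9 * (2 * t)) * (2 * t * m ^ 10 + 1)
          ≤ 2 * (m ^ 9 * (2 * t)) * (3 * (t * m ^ 10)) := by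
            refine Nat.mul_le_mul_left _ ?_
            have : 2 * t * m ^ 10 = 2 * (t * m ^ 10) := by ring
            omega
        _ = 12 * t ^ 2 * m ^ 19 := by ring
        _ ≤ 12 * (4 * d * m ^ 2) * m ^ 19 := by gcongr
        _ = 48 * (d * m ^ 21) := by ring
    have h3 := hdpm 21 22 (by norm_num)
    have h4 := hdpm 4 22 (by norm_num)
    have h5 : m ^ 9 ≤ d * m ^ 9 := Nat.le_mul_of_pos_left _ hd0
    have h6 := hdpm 9 22 (by norm_num)
    omega
  -- The small stars avoid `W` and the big centres. They may meet the leaves of the big stars, which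
  -- is harmless: the links avoid all centres and one another.
  obtain ⟨cB, lB, hB, hBd⟩ := exists_disjoint_stars (W := W ∪ (range (m ^ 9)).image cA) hVne
    (2 * (m ^ 9 * (2 * t))) (2 * t * m ^ 10) hsup hk hLB
  have hF : W.card + (m ^ 9 + 2 * (m ^ 9 * (2 * t))) + m ^ 9 * (2 * t) * (4 * m + 1) ≤
      2 * (d * m ^ 4) := by
    have h1 : m ^ 9 + 2 * (m ^ 9 * (2 * t)) + m ^ 9 * (2 * t) * (4 * m + 1) =
        m ^ 9 + 6 * (t * m ^ 9) + 8 * (t * m ^ 10) := by ring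
    have h2 : m ^ 9 ≤ t * m ^ 9 := Nat.le_mul_of_pos_left _ ht0
    have h3 := htpm 9 20 (by norm_num)
    have h4 := htpm 10 20 (by norm_num)
    omega
  have hA' : ∀ i < m ^ 9, C (cA i) = β := fun i hi => (mem_filter.1 (hA i hi).1).2
  have hB' : ∀ i < 2 * (m ^ 9 * (2 * t)), C (cB i) = β := fun i hi => (mem_filter.1 (hB i hi).1).2
  -- m⁹ big stars receive m⁹·2t links, so one of them receives 2t. Twice as many small stars as
  -- links keeps half of them free. `D` is m⁴ times the bound 2dm⁴ of `hF` on the vertices to avoid.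
  obtain ⟨f, hf, hf'⟩ := hG.exists_links hreg C β (cA := cA) (cB := cB) (lA := lA) (lB := lB)
    (NA := m ^ 9) (NB := 2 * (m ^ 9 * (2 * t))) (kA := d / 2) (kB := 2 * t * m ^ 10)
    (Q := m ^ 9 * (2 * t)) (D := 2 * (d * m ^ 8)) (T := 4 * m) (W := W)
    (fun i hi => ⟨hA' i hi, (hA i hi).2.2.1, (hA i hi).2.2.2.1⟩)
    (fun i hi => ⟨hB' i hi, (hB i hi).2.2.1, (hB i hi).2.2.2.1⟩)
    (fun j hj i hi => (hAd j hj i hi).mono (subset_insert _ _) (subset_insert _ _))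
    (fun j hj i hi => (hBd j hj i hi).mono (subset_insert _ _) (subset_insert _ _))
    (by
      have h1 : d ≤ d * m ^ 8 := Nat.le_mul_of_pos_right _ (by positivity)
      omega)
    (by
      have h1 : d * (1000 * m ^ 8) ≤ 3 * (d / 2) * m ^ 9 :=
        Nat.mul_le_mul (by omega) (hpm 8 9 (by norm_num))
      have h2 : 3 * (d / 2) * m ^ 9 = 3 * (m ^ 9 * (d / 2)) := by ring
      have h3 : d * (1000 * m ^ 8) = 1000 * (d * m ^ 8) := by ring
      have h4 := hdpm 4 8 (by norm_num)
      omega)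
    (by
      have h0 : 2 * (m ^ 9 * (2 * t)) - m ^ 9 * (2 * t) = m ^ 9 * (2 * t) := by omega
      have h1 : 4 * (d * m ^ 19) ≤ m ^ 9 * (2 * t) * (2 * t * m ^ 10) := by
        calc 4 * (d * m ^ 19) ≤ 4 * (t ^ 2 * m ^ 19) := by gcongr
          _ = _ := by ring
      rw [h0]
      have h4 := hdpm 4 19 (by norm_num)
      have h5 := hdpm 8 19 (by norm_num)
      omega)
    (by
      calc _ ≤ 2 * (d * m ^ 4) * m ^ 4 := Nat.mul_le_mul_right _ hF
        _ = 2 * (d * m ^ 8) := by ring)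
    ⟨2 * m, by ring⟩ (by omega) (by
      have := hpm 1 4 (by norm_num)
      rw [pow_one] at this
      omega)
  obtain ⟨i, hi, hfib⟩ := exists_le_card_fiber_of_mul_le_card_of_maps_to
    (s := range (m ^ 9 * (2 * t))) (t := range (m ^ 9)) (f := fun q => (f q).i) (n := 2 * t)
    (fun q hq => mem_range.2 (hf q (mem_range.1 hq)).1) ⟨0, mem_range.2 (by positivity)⟩
    (by rw [card_range, card_range])
  obtain ⟨S, hS, hSc⟩ := exists_subset_card_eq hfib
  obtain ⟨H, hH, hHW, hroot⟩ := exists_hub_of_links (W := W) (i := i) (mem_range.1 hi)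
    (fun i hi => ⟨(hA i hi).2.1, (hA i hi).2.2.1⟩)
    (fun i hi => ⟨fun h => (hB i hi).2.1 (mem_union_left _ h), (hB i hi).2.2.1, (hB i hi).2.2.2.1⟩)
    hBd
    (fun i hi j hj he => (hB j hj).2.1
      (mem_union_right _ (mem_image.2 ⟨i, mem_range.2 hi, he⟩)))
    hf hf' hSc (fun q hq => by
      have := mem_filter.1 (hS hq)
      exact ⟨mem_range.1 this.1, this.2⟩)
  exact ⟨H, hH, hHW, hroot ▸ hA' i (mem_range.1 hi)⟩

/-- A system of hubs with disjoint inner parts. -/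
theorem EdgeExpanding.exists_hub_system {d e m r t : ℕ} (hG : EdgeExpanding G d e)
    (hreg : Regime (Fintype.card V) d e m r) (hdeg : ∀ v, d ≤ G.degree v)
    (C : G.Coloring Bool) (β : Bool)
    (hSide : Fintype.card V ≤ 2 * (univ.filter fun v => C v = β).card)
    (ht1 : d ≤ t ^ 2) (ht2 : t ^ 2 ≤ 4 * d * m ^ 2) (hno : ¬ ContainsTK G t 1) :
    ∃ H : Fin t → Hub G (2 * t), (∀ i, (H i).IsProper (4 * m + 2) (2 * t * m ^ 10) ∧
        C (H i).root = β) ∧ ∀ i j, i ≠ j → Disjoint (H i).inner (H j).inner := by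
  obtain ⟨H₀, -, -, -⟩ := hG.exists_hub hreg hdeg C β hSide ht1 ht2 hno ∅ (by simp)
  have : Nonempty (Hub G (2 * t)) := ⟨H₀⟩
  obtain ⟨f, hf, hf'⟩ := exists_greedy_sequence (α := Hub G (2 * t)) t
    (fun _ H => H.IsProper (4 * m + 2) (2 * t * m ^ 10) ∧ C H.root = β)
    (fun H H' => Disjoint H.inner H'.inner) (by
      intro q hq f hf _
      obtain ⟨H, h1, h2, h3⟩ := hG.exists_hub hreg hdeg C β hSide ht1 ht2 hno
        ((range q).biUnion fun i => (f i).inner) (by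
          have hm := hreg.m_large
          calc ((range q).biUnion fun i => (f i).inner).card
              ≤ (range q).card * (2 * t * (4 * m + 2 + 1)) :=
                card_biUnion_le_card_mul _ _ _ fun i hi =>
                  (hf i (mem_range.1 hi)).1.card_inner_le
            _ ≤ t * (2 * t * (5 * m)) := by
                rw [card_range]
                gcongr
                omega
            _ = 10 * (t ^ 2) * m := by ring
            _ ≤ 10 * (4 * d * m ^ 2) * m := by gcongr
            _ = d * (40 * m ^ 3) := by ring
            _ ≤ d * (m * m ^ 3) := by gcongr; omega
            _ = d * m ^ 4 := by ring)
      refine ⟨H, ⟨h1, h3⟩, fun i hi => ?_⟩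
      exact (h2.symm).mono_left (subset_biUnion_of_mem (fun i => (f i).inner) (mem_range.2 hi)))
  refine ⟨fun i => f i, fun i => hf i i.2, fun i j hij => ?_⟩
  rcases lt_or_gt_of_ne (fun h => hij (Fin.ext h) : (i : ℕ) ≠ j) with h | h
  · exact hf' j j.2 i h
  · exact (hf' i i.2 j h).symm

end HubSystem

/-! ### Joining the hubs -/

/-- A path joining leaf sets of two hubs, with the hubs and the tips used. -/
structure Join {V : Type*} (G : SimpleGraph V) (t s : ℕ) where
  i : Fin t
  j : Fin t
  p : Fin s
  q : Fin s
  a : V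
  b : V
  walk : G.Walk a b

section Assembly

variable {V : Type*} [Fintype V] [DecidableEq V] {G : SimpleGraph V} [DecidableRel G.Adj]

/-- A system of hubs whose leaves are joined by disjoint paths contains a balanced subdivision. -/
theorem containsTK_of_joins {t s r k T ℓ : ℕ} (hs : 0 < s) (H : Fin t → Hub G s)
    (hH : ∀ i, (H i).IsProper r k) (hHd : ∀ i j, i ≠ j → Disjoint (H i).inner (H j).inner)
    (g : {x : Fin t × Fin t // x.1 < x.2} → Join G t s)
    (hg : ∀ x, (g x).a ∈ (H x.1.1).leaf (g x).p ∧ (g x).b ∈ (H x.1.2).leaf (g x).q ∧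
      (g x).walk.IsPath ∧ (g x).walk.length = T ∧
      ∀ z ∈ (g x).walk.support, ∀ i, z ∉ (H i).inner)
    (hslot : ∀ x y, x ≠ y → (x.1.1, (g x).p) ≠ (y.1.1, (g y).p) ∧
      (x.1.1, (g x).p) ≠ (y.1.2, (g y).q) ∧ (x.1.2, (g x).q) ≠ (y.1.1, (g y).p) ∧
      (x.1.2, (g x).q) ≠ (y.1.2, (g y).q))
    (hdisj : ∀ x y, x ≠ y → ∀ z ∈ (g x).walk.support, z ∉ (g y).walk.support)
    (hℓ : 2 * r + 2 + T = ℓ + 1) : ContainsTK G t ℓ := by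
  have hin : ∀ i p, ∀ z ∈ ((H i).walk p).support, z ∈ (H i).inner := fun i p z hz =>
    Hub.mem_inner p hz
  have hroot : ∀ i, (H i).root ∈ (H i).inner := fun i =>
    hin i ⟨0, hs⟩ _ (SimpleGraph.Walk.start_mem_support _)
  have heq : ∀ i j z, z ∈ (H i).inner → z ∈ (H j).inner → i = j := by
    intro i j z hz hz'
    by_contra hij
    exact (Finset.disjoint_left.1 (hHd i j hij)) hz hz'
  let c : Fin t ↪ V := ⟨fun i => (H i).root, fun i j (hij : (H i).root = (H j).root) =>
    heq i j _ (hroot i) (hij ▸ hroot j)⟩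
  have hadjA : ∀ x, G.Adj ((H x.1.1).tip (g x).p) (g x).a := fun x =>
    (G.mem_neighborFinset _ _).1 ((hH _).leaf_subset _ (hg x).1)
  have hadjB : ∀ x, G.Adj (g x).b ((H x.1.2).tip (g x).q) := fun x =>
    ((G.mem_neighborFinset _ _).1 ((hH _).leaf_subset _ (hg x).2.1)).symm
  -- Root, tip, leaf, join, leaf, tip, root: the length is r + 1 + T + 1 + r.
  let P : ∀ x : {x : Fin t × Fin t // x.1 < x.2}, G.Walk (c x.1.1) (c x.1.2) := fun x =>
    ((H x.1.1).walk (g x).p).append (.cons (hadjA x) ((g x).walk.append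
      (.cons (hadjB x) ((H x.1.2).walk (g x).q).reverse)))
  have hsupp : ∀ x z, z ∈ (P x).support ↔ z ∈ ((H x.1.1).walk (g x).p).support ∨
      z ∈ (g x).walk.support ∨ z ∈ ((H x.1.2).walk (g x).q).support := by
    intro x z
    simp only [P, SimpleGraph.Walk.mem_support_append_iff, SimpleGraph.Walk.support_cons,
      List.mem_cons, SimpleGraph.Walk.support_reverse, List.mem_reverse]
    constructor
    · rintro (h | h | h | h | h)
      · exact Or.inl h
      · exact Or.inl (by rw [h]; exact SimpleGraph.Walk.end_mem_support _)
      · exact Or.inr (Or.inl h)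
      · exact Or.inr (Or.inl (by rw [h]; exact SimpleGraph.Walk.end_mem_support _))
      · exact Or.inr (Or.inr h)
    · rintro (h | h | h)
      · exact Or.inl h
      · exact Or.inr (Or.inr (Or.inl h))
      · exact Or.inr (Or.inr (Or.inr (Or.inr h)))
  have hav : ∀ x, ∀ z ∈ (g x).walk.support, ∀ i, z ∉ (H i).inner := fun x => (hg x).2.2.2.2
  -- Distinct pairs of hubs use distinct (hub, tip) slots, so their hub segments can meet only at a
  -- common root.
  have hslots : ∀ i j p q, (i, p) ≠ (j, q) → ∀ z ∈ ((H i).walk p).support,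
      z ∈ ((H j).walk q).support → z = (H i).root := by
    intro i j p q hne z hz hz'
    obtain rfl := heq i j z (hin i p z hz) (hin j q z hz')
    exact (hH i).eq_root p q (fun h => hne (by rw [h])) z hz hz'
  have hpath : ∀ x, (P x).IsPath ∧ (P x).length = ℓ + 1 := by
    intro x
    have hx12 : x.1.1 ≠ x.1.2 := x.2.ne
    have h1 : (SimpleGraph.Walk.cons (hadjB x) ((H x.1.2).walk (g x).q).reverse).IsPath := by
      refine (SimpleGraph.Walk.cons_isPath_iff _ _).2 ⟨((hH _).isPath _).reverse, ?_⟩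
      rw [SimpleGraph.Walk.support_reverse, List.mem_reverse]
      exact fun h => hav x _ (SimpleGraph.Walk.end_mem_support _) _ (hin _ _ _ h)
    have h2 : ((g x).walk.append
        (.cons (hadjB x) ((H x.1.2).walk (g x).q).reverse)).IsPath := by
      refine isPath_append (hg x).2.2.1 h1 fun z hz hz' => ?_
      rw [SimpleGraph.Walk.support_cons, List.mem_cons, SimpleGraph.Walk.support_reverse,
        List.mem_reverse] at hz'
      exact hz'.resolve_right fun h => hav x z hz _ (hin _ _ _ h)
    have hout : ∀ z ∈ (H x.1.1).inner, z ∉ ((g x).walk.append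
        (.cons (hadjB x) ((H x.1.2).walk (g x).q).reverse)).support := by
      intro z hz hz'
      rw [SimpleGraph.Walk.mem_support_append_iff, SimpleGraph.Walk.support_cons, List.mem_cons,
        SimpleGraph.Walk.support_reverse, List.mem_reverse] at hz'
      rcases hz' with h | h | h
      · exact hav x z h _ hz
      · exact hav x _ (SimpleGraph.Walk.end_mem_support _) x.1.1 (h ▸ hz)
      · exact hx12 (heq _ _ z hz (hin _ _ _ h))
    refine ⟨?_, ?_⟩
    · refine isPath_append ((hH _).isPath _) ((SimpleGraph.Walk.cons_isPath_iff _ _).2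
        ⟨h2, hout _ (hin _ _ _ (SimpleGraph.Walk.end_mem_support _))⟩) fun z hz hz' => ?_
      rw [SimpleGraph.Walk.support_cons, List.mem_cons] at hz'
      exact hz'.resolve_right (hout z (hin _ _ _ hz))
    · have e1 := (hH x.1.1).length (g x).p
      have e2 := (hH x.1.2).length (g x).q
      have e3 := (hg x).2.2.2.1
      simp only [P, SimpleGraph.Walk.length_append, SimpleGraph.Walk.length_cons,
        SimpleGraph.Walk.length_reverse]
      omega
  have hcross : ∀ x y, x ≠ y → ∀ v ∈ (P x).support, v ≠ (H x.1.1).root → v ≠ (H x.1.2).root →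
      v ∉ (P y).support := by
    intro x y hxy v hv hvi hvj hv'
    rw [hsupp] at hv hv'
    obtain ⟨s1, s2, s3, s4⟩ := hslot x y hxy
    rcases hv with h | h | h
    · rcases hv' with h' | h' | h'
      · exact hvi (hslots _ _ _ _ s1 v h h')
      · exact hav y v h' _ (hin _ _ _ h)
      · exact hvi (hslots _ _ _ _ s2 v h h')
    · rcases hv' with h' | h' | h'
      · exact hav x v h _ (hin _ _ _ h')
      · exact hdisj x y hxy v h h'
      · exact hav x v h _ (hin _ _ _ h')
    · rcases hv' with h' | h' | h'
      · exact hvj (hslots _ _ _ _ s3 v h h')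
      · exact hav y v h' _ (hin _ _ _ h)
      · exact hvj (hslots _ _ _ _ s4 v h h')
  refine ⟨c, fun i j hij => P ⟨(i, j), hij⟩, fun i j hij => hpath _, ?_, ?_⟩
  · intro i j hij k hk
    rw [hsupp] at hk
    rcases hk with h | h | h
    · exact Or.inl (heq _ _ _ (hroot k) (hin _ _ _ h))
    · exact absurd (hroot k) (hav _ _ h k)
    · exact Or.inr (heq _ _ _ (hroot k) (hin _ _ _ h))
  · intro i j hij i' j' hij' hne v hv hvi hvj
    exact hcross ⟨(i, j), hij⟩ ⟨(i', j'), hij'⟩ (fun h => hne (Subtype.mk.inj h)) v hv hvi hvj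

/-- The tips of hub `i` that are used by a partial system of joins number at most `t`. -/
theorem exists_used_tips {t s q : ℕ} (E : {x : Fin t × Fin t // x.1 < x.2} → ℕ)
    (f : ℕ → Join G t s)
    (hf : ∀ n < q, ∃ x, E x = n ∧ (f n).i = x.1.1 ∧ (f n).j = x.1.2) (i : Fin t) :
    ∃ S : Finset (Fin s), S.card ≤ t ∧ ∀ n < q, ((f n).i = i → (f n).p ∈ S) ∧
      ((f n).j = i → (f n).q ∈ S) := by
  classical
  rcases Nat.eq_zero_or_pos s with hs | hs
  · subst hs
    exact ⟨∅, by simp, fun n _ => (f n).p.elim0⟩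
  -- For each k there is only one pair {i, k}, hence one tip of hub `i` to record; at k = i the
  -- value is a dummy.
  let slot : Fin t → Fin s := fun k =>
    if h : i < k then (f (E ⟨(i, k), h⟩)).p
    else if h : k < i then (f (E ⟨(k, i), h⟩)).q else ⟨0, hs⟩
  refine ⟨univ.image slot, card_image_le.trans (by simp), fun n hn => ?_⟩
  obtain ⟨⟨⟨x1, x2⟩, hx⟩, hE, h1, h2⟩ := hf n hn
  simp only at h1 h2 hx
  constructor
  · intro h
    rw [h] at h1
    subst h1
    exact mem_image.2 ⟨x2, mem_univ _, by simp only [slot, dif_pos hx, hE]⟩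
  · intro h
    rw [h] at h2
    subst h2
    exact mem_image.2 ⟨x1, mem_univ _, by simp only [slot, dif_neg hx.asymm, dif_pos hx, hE]⟩

theorem Hub.IsProper.card_biUnion_leaf {s r k : ℕ} {H : Hub G s} (hH : H.IsProper r k)
    (J : Finset (Fin s)) : (J.biUnion H.leaf).card = J.card * k := by
  rw [card_biUnion fun p _ q _ hpq => hH.leaf_disjoint p q hpq,
    sum_congr rfl fun p _ => hH.leaf_card p, sum_const, smul_eq_mul]

/-- Unless there is a subdivision with all paths of length two, there is one with all paths of
length `80 m³`. -/
theorem EdgeExpanding.containsTK {d e m r t ℓ : ℕ} (hG : EdgeExpanding G d e)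
    (hreg : Regime (Fintype.card V) d e m r) (hdeg : ∀ v, d ≤ G.degree v)
    (C : G.Coloring Bool) (β : Bool)
    (hSide : Fintype.card V ≤ 2 * (univ.filter fun v => C v = β).card)
    (ht1 : d ≤ t ^ 2) (ht2 : t ^ 2 ≤ 4 * d * m ^ 2) (hno : ¬ ContainsTK G t 1)
    (hℓ : ℓ + 1 = 80 * m ^ 3) : ContainsTK G t ℓ := by
  obtain ⟨H, hH, hHd⟩ := hG.exists_hub_system hreg hdeg C β hSide ht1 ht2 hno
  have hm := hreg.m_large
  have hm0 : 0 < m := by omega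
  have hd0 : 0 < d := lt_of_lt_of_le (by positivity) hreg.pow_le_d
  have ht0 : 0 < t := by
    rcases Nat.eq_zero_or_pos t with h | h
    · subst h; simp at ht1; omega
    · exact h
  have hm3 : 1000 * m ≤ m ^ 3 := by
    calc 1000 * m ≤ m * m := Nat.mul_le_mul_right _ hm
      _ = m ^ 2 := by ring
      _ ≤ m ^ 3 := Nat.pow_le_pow_right hm0 (by norm_num)
  have hm4 : 1000 * m ^ 3 ≤ m ^ 4 := by
    calc 1000 * m ^ 3 ≤ m * m ^ 3 := Nat.mul_le_mul_right _ hm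
      _ = m ^ 4 := by ring
  -- Chosen so that 2(4m + 2) + 2 + T = 80m³.
  obtain ⟨T, hT⟩ : ∃ T, T = 80 * m ^ 3 - 8 * m - 6 := ⟨_, rfl⟩
  have hTeven : Even T := ⟨40 * m ^ 3 - 4 * m - 3, by omega⟩
  let ι := {x : Fin t × Fin t // x.1 < x.2}
  let E : ι ≃ Fin (Fintype.card ι) := Fintype.equivFin ι
  have hQ : Fintype.card ι ≤ t ^ 2 := by
    refine (Fintype.card_subtype_le _).trans ?_
    simp [pow_two]
  set I := (univ : Finset (Fin t)).biUnion fun i => (H i).inner with hI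
  have hIc : I.card ≤ t * (2 * t * (4 * m + 2 + 1)) := by
    have := card_biUnion_le_card_mul (univ : Finset (Fin t)) (fun i => (H i).inner) _
      fun i _ => (hH i).1.card_inner_le
    simpa using this
  have hVne : Nonempty V := ⟨(H ⟨0, ht0⟩).root⟩
  have : Nonempty (Join G t (2 * t)) := by
    obtain ⟨v⟩ := hVne
    exact ⟨⟨⟨0, ht0⟩, ⟨0, ht0⟩, ⟨0, by omega⟩, ⟨0, by omega⟩, v, v, .nil⟩⟩
  -- Hub walks have even length 4m + 2, so tips share the colour of the roots and all leaves have
  -- the opposite colour.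
  have hside : ∀ i p, ∀ v ∈ (H i).leaf p, C v = !β := by
    intro i p v hv
    have hadj := (G.mem_neighborFinset _ _).1 ((hH i).1.leaf_subset p hv)
    have h1 := C.valid hadj
    have h2 := (C.even_length_iff_congr ((H i).walk p)).1
      (by rw [(hH i).1.length p]; exact ⟨2 * m + 1, by ring⟩)
    rw [(hH i).2] at h2
    revert h1 h2
    cases C v <;> cases β <;> cases C ((H i).tip p) <;> simp
  obtain ⟨f, hf, hf'⟩ := exists_greedy_sequence (α := Join G t (2 * t)) (Fintype.card ι)
    (fun n x => (∃ y : ι, (E y : ℕ) = n ∧ x.i = y.1.1 ∧ x.j = y.1.2) ∧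
      x.a ∈ (H x.i).leaf x.p ∧ x.b ∈ (H x.j).leaf x.q ∧ x.walk.IsPath ∧ x.walk.length = T ∧
      ∀ z ∈ x.walk.support, z ∉ I)
    (fun x y => ((x.i, x.p) ≠ (y.i, y.p) ∧ (x.i, x.p) ≠ (y.j, y.q) ∧ (x.j, x.q) ≠ (y.i, y.p) ∧
      (x.j, x.q) ≠ (y.j, y.q)) ∧ ∀ z ∈ x.walk.support, z ∉ y.walk.support) (by
      intro q hq f hf _
      set y : ι := E.symm ⟨q, hq⟩ with hy
      set F := I ∪ (range q).biUnion fun n => (f n).walk.support.toFinset with hF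
      have hFc : F.card ≤ d * m ^ 6 := by
        have h1 : ((range q).biUnion fun n => (f n).walk.support.toFinset).card ≤
            t ^ 2 * (T + 1) := by
          refine (card_biUnion_le_card_mul _ _ (T + 1) fun n hn => ?_).trans ?_
          · refine (List.toFinset_card_le _).trans ?_
            rw [SimpleGraph.Walk.length_support, (hf n (mem_range.1 hn)).2.2.2.2.1]
          · rw [card_range]
            exact Nat.mul_le_mul_right _ (hq.le.trans hQ)
        calc F.card ≤ t * (2 * t * (4 * m + 2 + 1)) + t ^ 2 * (T + 1) :=
              (card_union_le _ _).trans (Nat.add_le_add hIc h1)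
          _ = t ^ 2 * (8 * m + 6 + T + 1) := by ring
          _ ≤ (4 * d * m ^ 2) * (81 * m ^ 3) := Nat.mul_le_mul ht2 (by omega)
          _ = d * (324 * m ^ 5) := by ring
          _ ≤ d * (m * m ^ 5) := by gcongr; omega
          _ = d * m ^ 6 := by ring
      -- At most t of the 2t tips are used, so at least t·2tm¹⁰ ≥ 2dm¹⁰ leaves remain, and `F`
      -- removes at most dm⁶ of them.
      have hleaves : ∀ i, ∃ J : Finset (Fin (2 * t)),
          (∀ p ∈ J, ∀ n < q, ((f n).i, (f n).p) ≠ (i, p) ∧ ((f n).j, (f n).q) ≠ (i, p)) ∧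
          d * m ^ 10 ≤ (J.biUnion (H i).leaf \ F).card := by
        intro i
        obtain ⟨S, hSc, hS⟩ := exists_used_tips (fun x => (E x : ℕ)) f
          (fun n hn => (hf n hn).1) i
        refine ⟨Sᶜ, ?_, ?_⟩
        · intro p hp n hn
          rw [mem_compl] at hp
          constructor
          · intro h
            rw [Prod.mk.injEq] at h
            exact hp (h.2 ▸ (hS n hn).1 h.1)
          · intro h
            rw [Prod.mk.injEq] at h
            exact hp (h.2 ▸ (hS n hn).2 h.1)
        · have h1 := le_card_sdiff F (Sᶜ.biUnion (H i).leaf)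
          rw [(hH i).1.card_biUnion_leaf] at h1
          have h2 : t ≤ Sᶜ.card := by
            rw [card_compl, Fintype.card_fin]
            omega
          have h3 : 2 * (d * m ^ 10) ≤ Sᶜ.card * (2 * t * m ^ 10) := by
            calc 2 * (d * m ^ 10) ≤ 2 * (t ^ 2 * m ^ 10) := by gcongr
              _ = t * (2 * t * m ^ 10) := by ring
              _ ≤ _ := Nat.mul_le_mul_right _ h2
          have h4 : d * m ^ 6 ≤ d * m ^ 10 :=
            Nat.mul_le_mul_left _ (Nat.pow_le_pow_right hm0 (by norm_num))
          omega
      obtain ⟨J, hJ, hJc⟩ := hleaves y.1.1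
      obtain ⟨J', hJ', hJc'⟩ := hleaves y.1.2
      obtain ⟨a, ha, b, hb, w, hw, hwl, hwF⟩ := hG.exists_path_of_length hreg C (!β)
        (A := J.biUnion (H y.1.1).leaf \ F) (B := J'.biUnion (H y.1.2).leaf \ F) (W := F)
        (D := d * m ^ 10) (T := T)
        (by
          intro v hv
          obtain ⟨p, -, hp⟩ := mem_biUnion.1 (mem_sdiff.1 hv).1
          exact hside _ _ v hp)
        (by
          intro v hv
          obtain ⟨p, -, hp⟩ := mem_biUnion.1 (mem_sdiff.1 hv).1
          exact hside _ _ v hp)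
        hJc hJc'
        (by
          rw [mul_comm]
          refine Nat.mul_le_mul_left _ ?_
          calc 2 ≤ m ^ 1 := by rw [pow_one]; omega
            _ ≤ m ^ 10 := Nat.pow_le_pow_right hm0 (by norm_num))
        (by
          calc F.card * m ^ 4 ≤ d * m ^ 6 * m ^ 4 := Nat.mul_le_mul_right _ hFc
            _ = d * m ^ 10 := by ring)
        hTeven (by omega) (by omega)
      obtain ⟨p, hp, hap⟩ := mem_biUnion.1 (mem_sdiff.1 ha).1
      obtain ⟨p', hp', hbp⟩ := mem_biUnion.1 (mem_sdiff.1 hb).1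
      refine ⟨⟨y.1.1, y.1.2, p, p', a, b, w⟩, ⟨⟨y, by simp [hy], rfl, rfl⟩, hap, hbp, hw, hwl,
        fun z hz h => hwF z hz (mem_union_left _ h)⟩, fun n hn => ⟨⟨(hJ p hp n hn).1,
          (hJ' p' hp' n hn).1, (hJ p hp n hn).2, (hJ' p' hp' n hn).2⟩, fun z hz hz' => ?_⟩⟩
      exact hwF z hz' (mem_union_right _
        (mem_biUnion.2 ⟨n, mem_range.2 hn, List.mem_toFinset.2 hz⟩)))
  have hfi : ∀ x : ι, (f (E x)).i = x.1.1 ∧ (f (E x)).j = x.1.2 := by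
    intro x
    obtain ⟨y, hy, h1, h2⟩ := (hf (E x) (E x).2).1
    have : y = x := E.injective (Fin.ext hy)
    rw [h1, h2, this]
    exact ⟨rfl, rfl⟩
  refine containsTK_of_joins (T := T) (r := 4 * m + 2) (by omega) H (fun i => (hH i).1) hHd
    (fun x => f (E x)) ?_ ?_ ?_ (by omega)
  · intro x
    obtain ⟨-, h1, h2, h3, h4, h5⟩ := hf (E x) (E x).2
    rw [(hfi x).1] at h1
    rw [(hfi x).2] at h2
    exact ⟨h1, h2, h3, h4, fun z hz i hzi => h5 z hz (mem_biUnion.2 ⟨i, mem_univ _, hzi⟩)⟩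
  · intro x y hxy
    rw [← (hfi x).1, ← (hfi x).2, ← (hfi y).1, ← (hfi y).2]
    have hne : (E x : ℕ) ≠ E y := fun h => hxy (E.injective (Fin.ext h))
    rcases lt_or_gt_of_ne hne with h | h
    · exact (hf' _ (E y).2 _ h).1
    · obtain ⟨s1, s2, s3, s4⟩ := (hf' _ (E x).2 _ h).1
      exact ⟨s1.symm, s3.symm, s2.symm, s4.symm⟩
  · intro x y hxy z hz hz'
    have hne : (E x : ℕ) ≠ E y := fun h => hxy (E.injective (Fin.ext h))
    rcases lt_or_gt_of_ne hne with h | h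
    · exact (hf' _ (E y).2 _ h).2 z hz hz'
    · exact (hf' _ (E x).2 _ h).2 z hz' hz

end Assembly

/-! ### From robust expansion to the numerical regime -/

/-- Take F to be all edges between X and Z. If there were at most d|X|/e of them, robustness would
allow deleting F and still leave at least |X|/e external neighbours of X. All of these lie outside X
∪ Z, where there is too little room. -/
theorem IsRobustExpander.edgeExpanding {V : Type*} [Fintype V] [DecidableEq V] {G : SimpleGraph V}
    [DecidableRel G.Adj] {ε₁ k : ℝ} {d e : ℕ} (h : IsRobustExpander G ε₁ k)
    (hdeg : ∀ v, d ≤ G.degree v) (hkd : k / 2 ≤ d)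
    (hexp : ∀ x : ℝ, (d : ℝ) ≤ x → x ≤ Fintype.card V / 2 → 1 ≤ e * expansion ε₁ k x) :
    EdgeExpanding G d e := by
  classical
  intro X Z hXZ hdX hXn hsmall
  by_contra! hcon
  let F : SimpleGraph V :=
    { Adj := fun u v => G.Adj u v ∧ ((u ∈ X ∧ v ∈ Z) ∨ (u ∈ Z ∧ v ∈ X))
      symm := ⟨fun u v huv => ⟨huv.1.symm, by tauto⟩⟩
      loopless := ⟨fun u hu => G.loopless.irrefl u hu.1⟩ }
  have hFG : F ≤ G := fun u v huv => huv.1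
  have hXpos : 0 < X.card := by omega
  have hF : F.edgeSet.ncard ≤ ∑ x ∈ X, (Z.filter (G.Adj x)).card := by
    have hsub : F.edgeSet ⊆
        (X.biUnion fun x => (Z.filter (G.Adj x)).image fun z => s(x, z) : Finset (Sym2 V)) := by
      intro s hs
      induction s with
      | _ u v =>
        rw [SimpleGraph.mem_edgeSet] at hs
        rw [mem_coe, mem_biUnion]
        rcases hs.2 with h' | h'
        · exact ⟨u, h'.1, mem_image.2 ⟨v, mem_filter.2 ⟨h'.2, hs.1⟩, rfl⟩⟩
        · exact ⟨v, h'.2, mem_image.2 ⟨u, mem_filter.2 ⟨h'.1, hs.1.symm⟩, Sym2.eq_swap⟩⟩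
    refine (Set.ncard_le_ncard hsub (finite_toSet _)).trans ?_
    rw [Set.ncard_coe_finset]
    exact card_biUnion_le.trans (sum_le_sum fun x _ => card_image_le)
  have hN : (extNbhd (G \ F) (X : Set V)).ncard ≤ (X ∪ Z)ᶜ.card := by
    rw [← Set.ncard_coe_finset]
    refine Set.ncard_le_ncard ?_ (finite_toSet _)
    rintro w ⟨hwX, v, hvX, hvw⟩
    rw [SimpleGraph.sdiff_adj] at hvw
    rw [mem_coe, mem_compl, mem_union]
    rintro (hw | hw)
    · exact hwX hw
    · exact hvw.2 ⟨hvw.1, Or.inl ⟨hvX, hw⟩⟩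
  have hVpos : (0 : ℝ) < Fintype.card V := by
    have : X.card ≤ Fintype.card V := card_le_univ _
    exact_mod_cast (by omega : 0 < Fintype.card V)
  have havg : (d : ℝ) ≤ avgDegree G := by
    rw [avgDegree, le_div_iff₀ hVpos]
    have : ∑ _v : V, (d : ℝ) ≤ ∑ v : V, (G.degree v : ℝ) :=
      sum_le_sum fun v _ => by exact_mod_cast hdeg v
    rw [sum_const, card_univ, nsmul_eq_mul] at this
    linarith
  have hdX' : (d : ℝ) ≤ X.card := by exact_mod_cast hdX
  have hXn' : (X.card : ℝ) ≤ Fintype.card V / 2 := by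
    have : (2 : ℝ) * X.card ≤ Fintype.card V := by exact_mod_cast hXn
    linarith
  have hex := hexp X.card hdX' hXn'
  set ε := expansion ε₁ k X.card with hε
  have hepos : (0 : ℝ) ≤ e := Nat.cast_nonneg e
  have hεpos : 0 ≤ ε := by
    by_contra! hneg
    nlinarith
  have hXr : (0 : ℝ) < X.card := by exact_mod_cast hXpos
  have hbound : (F.edgeSet.ncard : ℝ) ≤ avgDegree G * ε * X.card := by
    have h1 : (F.edgeSet.ncard : ℝ) * e ≤ d * X.card := by
      have : e * F.edgeSet.ncard ≤ d * X.card := (Nat.mul_le_mul_left e hF).trans hcon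
      rw [mul_comm]
      exact_mod_cast this
    have h0 : (0 : ℝ) ≤ F.edgeSet.ncard := Nat.cast_nonneg _
    calc (F.edgeSet.ncard : ℝ) ≤ F.edgeSet.ncard * (e * ε) := le_mul_of_one_le_right h0 hex
      _ = (F.edgeSet.ncard * e) * ε := by ring
      _ ≤ (d * X.card) * ε := mul_le_mul_of_nonneg_right h1 hεpos
      _ ≤ (avgDegree G * X.card) * ε := by gcongr
      _ = _ := by ring
  have hfin := h X (hkd.trans hdX') hXn' F hFG hbound
  have h2 : (X.card : ℝ) ≤ e * (X ∪ Z)ᶜ.card := by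
    calc (X.card : ℝ) ≤ (e * ε) * X.card := le_mul_of_one_le_left hXr.le hex
      _ = e * (ε * X.card) := by ring
      _ ≤ e * (extNbhd (G \ F) (X : Set V)).ncard := by gcongr
      _ ≤ e * (X ∪ Z)ᶜ.card := by gcongr
  have h3 : X.card ≤ e * (X ∪ Z)ᶜ.card := by exact_mod_cast h2
  omega

/-- The expansion function is bounded below on the relevant range. -/
theorem one_le_mul_expansion {ε₁ ε₂ d n x L e : ℝ} (hε₁ : 0 < ε₁) (hε₂ : 0 < ε₂) (hε₂' : ε₂ < 1)
    (hd : 0 < d) (hL : L = Real.log (n / d)) (hL1 : 15 / ε₂ ≤ L) (he : 4 * L ^ 2 / ε₁ ≤ e)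
    (hdx : d ≤ x) (hxn : x ≤ n / 2) : 1 ≤ e * expansion ε₁ (ε₂ * d) x := by
  have hL0 : 0 < L := lt_of_lt_of_le (by positivity) hL1
  have hx : 0 < x := hd.trans_le hdx
  have hn : 0 < n := by linarith
  have hεd : ε₂ * d ≤ d := by nlinarith
  rw [expansion, if_neg (by push Not; linarith)]
  have h15 : 15 ≤ 15 * x / (ε₂ * d) := by
    rw [le_div_iff₀ (by positivity)]
    nlinarith
  have hlogpos : 0 < Real.log (15 * x / (ε₂ * d)) := Real.log_pos (by linarith)
  have hlog : Real.log (15 * x / (ε₂ * d)) ≤ 2 * L := by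
    -- The logarithm splits into log(15/ε₂), at most `L` by `hL1`, and log(n/d) = L.
    have h1 : 15 * x / (ε₂ * d) ≤ (15 / ε₂) * (n / d) := by
      rw [div_mul_div_comm]
      gcongr
      linarith
    have h2 := Real.log_le_log (by linarith) h1
    rw [Real.log_mul (by positivity) (by positivity), ← hL] at h2
    have h3 := Real.log_le_sub_one_of_pos (show 0 < 15 / ε₂ by positivity)
    linarith
  have hsq : Real.log (15 * x / (ε₂ * d)) ^ 2 ≤ 4 * L ^ 2 := by
    have := pow_le_pow_left₀ hlogpos.le hlog 2
    linarith [this, show (2 * L) ^ 2 = 4 * L ^ 2 by ring]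
  rw [mul_div_assoc', le_div_iff₀ (by positivity), one_mul]
  rw [div_le_iff₀ hε₁] at he
  linarith

/-- Inverts 1 − 1/(a+1) ≤ exp(−1/(a+1)). With a = 4e it shows that `r` growth rounds multiply the
size by at least n/d. -/
theorem exp_le_one_add_inv_pow {a r : ℕ} (ha : 0 < a) :
    Real.exp (r / (a + 1)) ≤ ((a + 1 : ℝ) / a) ^ r := by
  have ha' : (0 : ℝ) < a := by exact_mod_cast ha
  have h1 : Real.exp (1 / (a + 1)) ≤ (a + 1) / a := by
    have h2 := Real.add_one_le_exp (-(1 / ((a : ℝ) + 1)))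
    have h3 : (-(1 / ((a : ℝ) + 1))) + 1 = a / (a + 1) := by field_simp; ring
    rw [h3, Real.exp_neg] at h2
    have h4 := inv_anti₀ (by positivity) h2
    rwa [inv_inv, inv_div] at h4
  have h5 : Real.exp (r / (a + 1)) = Real.exp (1 / (a + 1)) ^ r := by
    rw [← Real.exp_nat_mul]
    congr 1
    ring
  rw [h5]
  exact pow_le_pow_left₀ (Real.exp_pos _).le h1 r

/-- Used for dm³⁰⁰ ≤ n: m ≤ L⁴ gives the exponent 1200, and the factor 2 absorbs the rounding of d.
One term of the exponential series suffices. -/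
theorem exists_two_mul_pow_le_exp : ∃ Λ : ℝ, ∀ L : ℝ, Λ ≤ L → 2 * L ^ 1200 ≤ Real.exp L := by
  obtain ⟨c, hc, hcb⟩ : ∃ c : ℝ, 0 < c ∧ ∀ L : ℝ, 0 ≤ L → L ^ 1201 / c ≤ Real.exp L :=
    ⟨(Nat.factorial 1201 : ℝ), by exact_mod_cast Nat.factorial_pos _,
      fun L hL => Real.pow_div_factorial_le_exp L hL 1201⟩
  refine ⟨2 * c, fun L hL => ?_⟩
  have hL0 : 0 < L := by linarith
  refine le_trans ?_ (hcb L hL0.le)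
  rw [le_div_iff₀ hc]
  calc 2 * L ^ 1200 * c = L ^ 1200 * (2 * c) := by ring
    _ ≤ L ^ 1200 * L := by gcongr
    _ = L ^ 1201 := by ring

/-- The parameters of the main theorem are in the required regime. -/
theorem regime_of_large {ε₁ d L : ℝ} {n : ℕ} (hε₁ : 0 < ε₁) (hε₁' : ε₁ < 1) (hd : 1 ≤ d)
    (hL : L = Real.log (n / d)) (hn : 0 < n) (hlog : Real.log n ^ 800 ≤ d) (hL1 : 160 / ε₁ ≤ L)
    (hL2 : 2 * L ^ 1200 ≤ Real.exp L) :
    Regime n ⌈d⌉₊ ⌈4 * L ^ 2 / ε₁⌉₊ (mParam n d) (mParam n d / 4) := by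
  have hL160 : 160 ≤ L := by
    refine le_trans ?_ hL1
    rw [le_div_iff₀ hε₁]
    linarith
  have hd0 : 0 < d := by linarith
  have hnr : (0 : ℝ) < n := by exact_mod_cast hn
  have hm : mParam n d = ⌊L ^ 4⌋₊ := by rw [mParam, hL]
  rw [hm]
  set m := ⌊L ^ 4⌋₊ with hmdef
  set e := ⌈4 * L ^ 2 / ε₁⌉₊ with hedef
  have hmL : (m : ℝ) ≤ L ^ 4 := Nat.floor_le (by positivity)
  have hLm : L ^ 4 < m + 1 := Nat.lt_floor_add_one _
  have heL : 4 * L ^ 2 / ε₁ ≤ e := Nat.le_ceil _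
  have heL' : (e : ℝ) < 4 * L ^ 2 / ε₁ + 1 := Nat.ceil_lt_add_one (by positivity)
  have hq : 0 < 4 * L ^ 2 / ε₁ := by positivity
  have hεL : 160 ≤ L * ε₁ := by rwa [div_le_iff₀ hε₁] at hL1
  have hL2pos : 0 < L ^ 2 := by positivity
  have hL2' : 25600 ≤ L ^ 2 := by nlinarith
  have hL4 : L ^ 4 = L ^ 2 * L ^ 2 := by ring
  have hquot : 40 * (4 * L ^ 2 / ε₁) ≤ L ^ 3 := by
    rw [← mul_div_assoc, div_le_iff₀ hε₁]
    have : L ^ 3 * ε₁ = L ^ 2 * (L * ε₁) := by ring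
    rw [this]
    nlinarith
  have hL3 : 160 * L ^ 3 ≤ L ^ 4 := by
    have h0 : (0 : ℝ) ≤ L ^ 3 := by positivity
    calc 160 * L ^ 3 ≤ L * L ^ 3 := by gcongr
      _ = L ^ 4 := by ring
  have hm1000 : 1000 ≤ m := by
    refine Nat.le_floor ?_
    push_cast
    nlinarith
  have hq1 : 100 ≤ 4 * L ^ 2 / ε₁ := by
    rw [le_div_iff₀ hε₁]
    nlinarith
  have hepos : 0 < e := Nat.ceil_pos.2 hq
  have hdd : (⌈d⌉₊ : ℝ) ≤ 2 * d := by
    have := Nat.ceil_lt_add_one hd0.le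
    linarith
  refine ⟨hm1000, hepos, ?_, by omega, by omega, ?_, ?_, ?_⟩
  · have : (e : ℝ) ≤ m := by linarith
    exact_mod_cast this
  · have hLlog : L ≤ Real.log n := by
      rw [hL]
      exact Real.log_le_log (by positivity) (div_le_self hnr.le hd)
    have h1 : (m : ℝ) ^ 200 ≤ ⌈d⌉₊ := by
      calc (m : ℝ) ^ 200 ≤ (L ^ 4) ^ 200 := by gcongr
        _ = L ^ 800 := by rw [← pow_mul]
        _ ≤ Real.log n ^ 800 := by gcongr
        _ ≤ d := hlog
        _ ≤ ⌈d⌉₊ := Nat.le_ceil _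
    exact_mod_cast h1
  · have h1 : (⌈d⌉₊ : ℝ) * m ^ 300 ≤ n := by
      calc (⌈d⌉₊ : ℝ) * m ^ 300 ≤ (2 * d) * (L ^ 4) ^ 300 := by gcongr
        _ = d * (2 * L ^ 1200) := by rw [← pow_mul]; ring
        _ ≤ d * Real.exp L := by gcongr
        _ = n := by
            rw [hL, Real.exp_log (by positivity)]
            field_simp
    exact_mod_cast h1
  · have hr : L ^ 4 / 8 ≤ ((m / 4 : ℕ) : ℝ) := by
      have h1 : m < 4 * (m / 4) + 4 := by omega
      have h2 : (m : ℝ) < 4 * ((m / 4 : ℕ) : ℝ) + 4 := by exact_mod_cast h1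
      nlinarith
    have h4e : (4 * e : ℝ) + 1 ≤ L ^ 3 / 8 := by linarith
    -- `r` is of order L⁴ and 4e + 1 at most of order L³, so r/(4e + 1) is at least L = log(n/d).
    have hexp : L ≤ ((m / 4 : ℕ) : ℝ) / ((4 * e : ℕ) + 1) := by
      rw [le_div_iff₀ (by positivity)]
      push_cast
      calc L * (4 * e + 1) ≤ L * (L ^ 3 / 8) := by gcongr
        _ = L ^ 4 / 8 := by ring
        _ ≤ _ := hr
    have h5 := exp_le_one_add_inv_pow (a := 4 * e) (r := m / 4) (by omega)
    have h6 : (n : ℝ) / d ≤ (((4 * e : ℕ) + 1 : ℝ) / (4 * e : ℕ)) ^ (m / 4) := by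
      calc (n : ℝ) / d = Real.exp L := by rw [hL, Real.exp_log (by positivity)]
        _ ≤ Real.exp (((m / 4 : ℕ) : ℝ) / ((4 * e : ℕ) + 1)) := Real.exp_le_exp.2 hexp
        _ ≤ _ := h5
    have he4 : (0 : ℝ) < (4 * e : ℕ) := by exact_mod_cast (by omega : 0 < 4 * e)
    rw [div_pow, div_le_div_iff₀ hd0 (by positivity)] at h6
    have h7 : (n : ℝ) * ((4 * e : ℕ) : ℝ) ^ (m / 4) ≤
        (⌈d⌉₊ : ℝ) * (((4 * e + 1 : ℕ)) : ℝ) ^ (m / 4) := by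
      calc (n : ℝ) * ((4 * e : ℕ) : ℝ) ^ (m / 4)
          ≤ ((4 * e : ℕ) + 1 : ℝ) ^ (m / 4) * d := h6
        _ = d * (((4 * e + 1 : ℕ)) : ℝ) ^ (m / 4) := by push_cast; ring
        _ ≤ _ := by gcongr; exact Nat.le_ceil _
    exact_mod_cast h7

/-- Since √d·m ≥ 1, rounding up at most doubles it. These two inequalities are all that the
construction needs to know about the number of branch vertices. -/
theorem ceil_sqrt_mul_bounds {d : ℝ} {m : ℕ} (hd : 1 ≤ d) (hm : 2 ≤ m) :
    ⌈d⌉₊ ≤ ⌈Real.sqrt d * m⌉₊ ^ 2 ∧ ⌈Real.sqrt d * m⌉₊ ^ 2 ≤ 4 * ⌈d⌉₊ * m ^ 2 := by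
  have hm' : (2 : ℝ) ≤ m := by exact_mod_cast hm
  have hs1 : 1 ≤ Real.sqrt d := Real.one_le_sqrt.2 hd
  have hsq : Real.sqrt d ^ 2 = d := Real.sq_sqrt (by linarith)
  set y := Real.sqrt d * m with hy
  have hy1 : 1 ≤ y := by nlinarith
  have hy2 : y ^ 2 = d * m ^ 2 := by rw [hy, mul_pow, hsq]
  have h1 : y ≤ ⌈y⌉₊ := Nat.le_ceil _
  have h2 : (⌈y⌉₊ : ℝ) < y + 1 := Nat.ceil_lt_add_one (by linarith)
  have h3 : (⌈d⌉₊ : ℝ) < d + 1 := Nat.ceil_lt_add_one (by linarith)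
  have h4 : d ≤ ⌈d⌉₊ := Nat.le_ceil _
  constructor
  · have : (⌈d⌉₊ : ℝ) ≤ (⌈y⌉₊ : ℝ) ^ 2 := by
      calc (⌈d⌉₊ : ℝ) ≤ d * 2 := by linarith
        _ ≤ d * m ^ 2 := by gcongr; nlinarith
        _ = y ^ 2 := hy2.symm
        _ ≤ _ := by gcongr
    exact_mod_cast this
  · have : (⌈y⌉₊ : ℝ) ^ 2 ≤ 4 * ⌈d⌉₊ * m ^ 2 := by
      calc (⌈y⌉₊ : ℝ) ^ 2 ≤ (2 * y) ^ 2 := by gcongr; linarith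
        _ = 4 * d * m ^ 2 := by rw [mul_pow, hy2]; ring
        _ ≤ _ := by gcongr
    exact_mod_cast this

/-- In the setting of the main theorem the minimum degree bound is at least one. -/
theorem one_le_of_log_pow_le {d K : ℝ} {n : ℕ} (hn : 2 ≤ n) (hK : 2 ^ 802 ≤ K) (hKd : K * d ≤ n)
    (hlog : Real.log n ^ 800 ≤ d) : 1 ≤ d := by
  -- If d < 1 then log n < 1, so n < 3. But log n ≥ 1/2 gives d ≥ 2⁻⁸⁰⁰, and then Kd ≥ 4 > n.
  by_contra! hd
  have hn2 : (2 : ℝ) ≤ n := by exact_mod_cast hn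
  have hl2 : 1 / 2 ≤ Real.log n := by
    have h1 := Real.log_two_gt_d9
    have h2 := Real.log_le_log (by norm_num) hn2
    linarith
  have hl1 : Real.log n < 1 := by
    by_contra! h
    have := one_le_pow₀ (n := 800) h
    linarith
  have hn3 : (n : ℝ) < 3 := by
    have h1 : (n : ℝ) < Real.exp 1 := by
      rw [← Real.log_lt_iff_lt_exp (by linarith)]
      exact hl1
    linarith [Real.exp_one_lt_d9]
  have hd' : (1 / 2 : ℝ) ^ 800 ≤ d := (pow_le_pow_left₀ (by norm_num) hl2 800).trans hlog
  have h4 : (4 : ℝ) ≤ K * d := by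
    calc (4 : ℝ) = 2 ^ 2 * (2 * (1 / 2)) ^ 800 := by norm_num
      _ = 2 ^ 802 * (1 / 2) ^ 800 := by rw [mul_pow, ← mul_assoc, ← pow_add]
      _ ≤ K * d := by
          have : (0 : ℝ) ≤ 2 ^ 802 := by positivity
          exact mul_le_mul hK hd' (by positivity) (this.trans hK)
  linarith

end BalancedSubdivision

/-! ### The main theorem: choice of the constant and the dichotomy -/

theorem mainTheorem2 (ε₁ ε₂ : ℝ) (hε₁ : 0 < ε₁) (hε₁' : ε₁ < 1) (hε₂ : 0 < ε₂) (hε₂' : ε₂ < 1) :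
    ∃ K₀ : ℝ, ∀ K : ℝ, K₀ ≤ K →
      ∀ (V : Type*) [Fintype V] (G : SimpleGraph V) [DecidableRel G.Adj] (n : ℕ) (d : ℝ),
        Fintype.card V = n → 0 < d →
        G.IsBipartite →
        BalancedSubdivision.IsRobustExpander G ε₁ (ε₂ * d) →
        d ≤ (G.minDegree : ℝ) →
        K * d ≤ (n : ℝ) →
        Real.log (n : ℝ) ^ 800 ≤ d →
        ∃ ℓ : ℕ,
          (ℓ = 1 ∨ ℓ + 1 = 80 * BalancedSubdivision.mParam n d ^ 3) ∧
          BalancedSubdivision.ContainsTK G ⌈Real.sqrt d * (BalancedSubdivision.mParam n d : ℝ)⌉₊ ℓ := by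
  open BalancedSubdivision in
  obtain ⟨Λ, hΛ⟩ := exists_two_mul_pow_le_exp
  -- The first term forces d ≥ 1; the second makes log(n/d) ≥ log K as large as all later estimates
  -- require.
  refine ⟨max (2 ^ 802) (Real.exp (max Λ (max (160 / ε₁) (15 / ε₂)))), ?_⟩
  intro K hK V _ G _ n d hn hd hbip hexp hdeg hKd hlog
  classical
  have hK1 : (2 : ℝ) ^ 802 ≤ K := (le_max_left _ _).trans hK
  have hK2 := (le_max_right _ _).trans hK
  have hKpos : 0 < K := (Real.exp_pos _).trans_le hK2
  have hmindeg : 0 < G.minDegree := by exact_mod_cast hd.trans_le hdeg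
  have hVne : Nonempty V := by
    by_contra h
    rw [not_nonempty_iff] at h
    simp at hmindeg
  have hn2 : 2 ≤ n := by
    have := G.minDegree_lt_card
    omega
  have hd1 := one_le_of_log_pow_le hn2 hK1 hKd hlog
  obtain ⟨L, hL⟩ : ∃ L, L = Real.log ((n : ℝ) / d) := ⟨_, rfl⟩
  have hLbig : max Λ (max (160 / ε₁) (15 / ε₂)) ≤ L := by
    rw [hL, Real.le_log_iff_exp_le (by positivity)]
    refine hK2.trans ?_
    rwa [le_div_iff₀ hd]
  have hL1 : Λ ≤ L := (le_max_left _ _).trans hLbig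
  have hL2 : 160 / ε₁ ≤ L := ((le_max_left _ _).trans (le_max_right _ _)).trans hLbig
  have hL3 : 15 / ε₂ ≤ L := ((le_max_right _ _).trans (le_max_right _ _)).trans hLbig
  have hreg := regime_of_large hε₁ hε₁' hd1 hL (by omega) hlog hL2 (hΛ L hL1)
  have hdeg' : ∀ v, ⌈d⌉₊ ≤ G.degree v := fun v =>
    (Nat.ceil_le.2 hdeg).trans (G.minDegree_le_degree v)
  have hG : EdgeExpanding G ⌈d⌉₊ ⌈4 * L ^ 2 / ε₁⌉₊ := by
    refine hexp.edgeExpanding hdeg' ?_ fun x hx hxn => ?_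
    · have := Nat.le_ceil d
      nlinarith
    · refine one_le_mul_expansion hε₁ hε₂ hε₂' hd hL hL3 (Nat.le_ceil _)
        ((Nat.le_ceil d).trans hx) ?_
      rw [hn] at hxn
      exact hxn
  obtain ⟨ht1, ht2⟩ := ceil_sqrt_mul_bounds hd1 (show 2 ≤ mParam n d by
    have := hreg.m_large
    omega)
  by_cases hone : ContainsTK G ⌈Real.sqrt d * (mParam n d : ℝ)⌉₊ 1
  · exact ⟨1, Or.inl rfl, hone⟩
  have C : G.Coloring Bool := SimpleGraph.Colorable.toColoring hbip (by simp)
  obtain ⟨β, hβ⟩ : ∃ β : Bool,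
      Fintype.card V ≤ 2 * (Finset.univ.filter fun v => C v = β).card := by
    have h := Finset.card_filter_add_card_filter_not (s := (Finset.univ : Finset V))
      (fun v => C v = true)
    simp only [Bool.not_eq_true, Finset.card_univ] at h
    by_cases h' : Fintype.card V ≤ 2 * (Finset.univ.filter fun v => C v = true).card
    · exact ⟨true, h'⟩
    · exact ⟨false, by omega⟩
  have hm0 : 0 < mParam n d ^ 3 := by
    have := hreg.m_large
    positivity
  refine ⟨80 * mParam n d ^ 3 - 1, Or.inr (by omega), ?_⟩
  subst hn
  exact hG.containsTK hreg hdeg' C β hβ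
    ht1 ht2 hone (by omega)
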